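/- Let $(\Omega,\mathscr G,P)$ be a probability space, $L^0$ the ring of (classes of) real-valued and $\bar L^0$ the set of (classes of) $[-\infty,\infty]$-valued $\mathscr G$-measurable random variables, with the almost sure order, and $L^0_{++}=\{m\in L^0: m>0\}$. Equip $L^0$ with the topology in which the balls $\{n:|m-n|\le\varepsilon\}$, $\varepsilon\in L^0_{++}$, form a neighbourhood base of $m$. In $\bar L^0$ use the conventions $\infty-\infty=-\infty$ and $0\cdot(\pm\infty)=0$. Let $\mathcal X$ be a conditional locally convex topological $L^0$-module, i.e. a topological $L^0$-module such that (1) for every countable measurable partition $(A_i)$ of $\Omega$ and every sequence $(X_i)$ in $\mathcal X$ there is exactly one $Y=\sum 1_{A_i}X_i\in\mathcal X$ with $1_{A_i}Y=1_{A_i}X_i$ for all $i$; (2) $0$ has a neighbourhood base of $L^0$-convex, $L^0$-absorbent, $L^0$-balanced and $\sigma$-stable sets; (3) if the $U_i$ are neighbourhoods of $0$ and $(A_i)$ is such a partition, then $\sum 1_{A_i}U_i$ is a neighbourhood of $0$. Here a set $\mathcal C$ is $\sigma$-stable if $\sum 1_{A_i}X_i\in\mathcal C$ for all such partitions and all $X_i\in\mathcal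 C$, and $L^0$-convex if $\lambda X+(1-\lambda)Y\in\mathcal C$ for $X,Y\in\mathcal C$ and $\lambda\in L^0$, $0\le\lambda\le1$. Let $\mathcal X^*$ be the module of continuous $L^0$-linear maps $\mathcal X\to L^0$, with the coarsest topology making all evaluations $X^*\mapsto\langle X^*,X\rangle=X^*(X)$ continuous. Let $\mathcal K\subseteq\mathcal X$ be a closed $L^0$-convex cone containing $0$ and $\mathcal K^\circ=\{X^*\in\mathcal X^*:\langle X^*,X\rangle\ge0\text{ for all }X\in\mathcal K\}$. Consider the following properties of a function $\pi:\mathcal K^\circ\to\bar L^0$: it is local, $\pi(1_AX^*+1_{A^c}Y^*)=1_A\pi(X^*)+1_{A^c}\pi(Y^*)$ for $A\in\mathscr G$; (a) it is positively homogeneous, $\pi(\lambda X^*)=\lambda\pi(X^*)$ for $\lambda\in L^0_{++}$, and concave, $\pi(\lambda X^*+(1-\lambda)Y^*)\ge\lambda\pi(X^*)+(1-\lambda)\pi(Y^*)$ for $\lambda\in L^0$, $0\le\lambda\le1$; (b) it is maximal invariant: if $\pi(X^*)=\infty$ for some $X^*\in\mathcal K^\circ$, then $\pi(Y^*)=\infty$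 for all $Y^*\in\mathcal K^\circ$; (c) it is upper semicontinuous: $\{X^*\in\mathcal K^\circ:\pi(X^*)\ge m\}$ is closed for all $m\in\bar L^0$. Let $\mathcal C\subseteq\mathcal X$ be closed, $L^0$-convex, monotone ($\mathcal C+\mathcal K=\mathcal C$) and $\sigma$-stable. Then the function $$\pi(X^*)=\operatorname*{ess\,inf}_{X\in\mathcal C}\langle X^*,X\rangle,\qquad X^*\in\mathcal K^\circ,$$ is well defined (the essential infimum being the greatest lower bound in $\bar L^0$, $=\infty$ if $\mathcal C=\emptyset$), is local, satisfies (a)--(c), and $$X\in\mathcal C\iff\langle X^*,X\rangle\ge\pi(X^*)\ \text{ for all }X^*\in\mathcal K^\circ.\qquad(\ast)$$ If $\mathcal C\ne\emptyset$, then $\pi(0)=0$, and $\pi$ is the unique local function on $\mathcal K^\circ$ with (a)--(c), $(\ast)$ and value $0$ at $0$; the normalisation at $0$ may be dropped if there is no $A\in\mathscr G$ with $P[A]>0$ and $1_A\mathcal C=1_A\mathcal X$. If $\mathcal C=\emptyset$, then $\pi\equiv\infty$ is the only local function with (a)--(c) that takes the value $\infty$ (almost surely) at some point of $\mathcal K^\circ$.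 -/

import Mathlib

open MeasureTheory Filter Topology

namespace CondModule

noncomputable section

variable {Ω : Type*} [MeasurableSpace Ω]

/-- `L⁰`: classes of real random variables modulo almost sure equality. -/
abbrev L0 (P : Measure Ω) := Ω →ₘ[P] ℝ

/-- Classes of random variables with values in `[-∞, ∞]`, ordered by the almost sure order. -/
abbrev ExtL0 (P : Measure Ω) := Ω →ₘ[P] EReal

variable {P : Measure Ω}

instance instCommRingL0 : CommRing (L0 P) :=
  { (AEEqFun.instAddCommGroup : AddCommGroup (L0 P)),
    (AEEqFun.instCommMonoid : CommMonoid (L0 P)) with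
    left_distrib := by
      intro a b c
      apply AEEqFun.ext
      filter_upwards [AEEqFun.coeFn_mul a (b + c), AEEqFun.coeFn_add b c,
        AEEqFun.coeFn_add (a * b) (a * c), AEEqFun.coeFn_mul a b, AEEqFun.coeFn_mul a c]
        with ω h1 h2 h3 h4 h5
      simp only [h1, h2, h3, h4, h5, Pi.mul_apply, Pi.add_apply]
      ring
    right_distrib := by
      intro a b c
      apply AEEqFun.ext
      filter_upwards [AEEqFun.coeFn_mul (a + b) c, AEEqFun.coeFn_add a b,
        AEEqFun.coeFn_add (a * c) (b * c), AEEqFun.coeFn_mul a c, AEEqFun.coeFn_mul b c]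
        with ω h1 h2 h3 h4 h5
      simp only [h1, h2, h3, h4, h5, Pi.mul_apply, Pi.add_apply]
      ring
    zero_mul := by
      intro a
      apply AEEqFun.ext
      filter_upwards [AEEqFun.coeFn_mul 0 a,
        (AEEqFun.coeFn_zero : ⇑(0 : L0 P) =ᵐ[P] 0)] with ω h1 h2
      simp [h1, h2]
    mul_zero := by
      intro a
      apply AEEqFun.ext
      filter_upwards [AEEqFun.coeFn_mul a 0,
        (AEEqFun.coeFn_zero : ⇑(0 : L0 P) =ᵐ[P] 0)] with ω h1 h2
      simp [h1, h2] }

/-- `L⁰₊₊`: the almost surely strictly positive elements of `L⁰`. -/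
def StrictPos (m : L0 P) : Prop := ∀ᵐ ω ∂P, 0 < m ω

/-- The ball `{n : |n| ≤ ε}` around `0` in `L⁰`. -/
def ball0 (ε : L0 P) : Set (L0 P) := {n | |n| ≤ ε}

theorem mem_ball0 {ε n : L0 P} : n ∈ ball0 ε ↔ ∀ᵐ ω ∂P, |n ω| ≤ ε ω := by
  change |n| ≤ ε ↔ _
  rw [← AEEqFun.coeFn_le]
  constructor
  · intro h
    filter_upwards [h, AEEqFun.coeFn_abs n] with ω h1 h2
    rwa [← h2]
  · intro h
    filter_upwards [h, AEEqFun.coeFn_abs n] with ω h1 h2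
    rwa [h2]

/-- Auxiliary construction of a positive element out of a positive continuous expression. -/
theorem exists_strictPos (x : L0 P) {ε : L0 P} (hε : StrictPos ε)
    (g : ℝ → ℝ → ℝ) (hg : Continuous (Function.uncurry g))
    (hpos : ∀ a b, 0 < b → 0 < g a b) :
    ∃ δ : L0 P, StrictPos δ ∧ ∀ᵐ ω ∂P, δ ω = g (x ω) (ε ω) := by
  refine ⟨AEEqFun.comp₂ g hg x ε, ?_, AEEqFun.coeFn_comp₂ g hg x ε⟩
  filter_upwards [hε, AEEqFun.coeFn_comp₂ g hg x ε] with ω h1 h2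
  rw [h2]
  exact hpos _ _ h1

theorem exists_ball_mul (x : L0 P) {ε : L0 P} (hε : StrictPos ε) :
    ∃ δ : L0 P, StrictPos δ ∧ ∀ n ∈ ball0 δ, x * n ∈ ball0 ε := by
  obtain ⟨δ, hδ, he⟩ := exists_strictPos x hε (fun a b => b * (1 + |a|)⁻¹)
    (by
      have h : ∀ p : ℝ × ℝ, (1 + |p.1|) ≠ 0 := fun p => by positivity
      exact continuous_snd.mul
        ((continuous_const.add continuous_fst.abs).inv₀ h))
    (fun a b hb => by positivity)
  refine ⟨δ, hδ, fun n hn => ?_⟩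
  rw [mem_ball0] at hn ⊢
  filter_upwards [hn, he, hε, AEEqFun.coeFn_mul x n] with ω h1 h2 h3 h4
  rw [h4, Pi.mul_apply, abs_mul]
  rw [h2] at h1
  calc |x ω| * |n ω| ≤ (1 + |x ω|) * (ε ω * (1 + |x ω|)⁻¹) := by
        apply mul_le_mul (by linarith) h1 (abs_nonneg _) (by positivity)
    _ = ε ω := by
        have : (1 + |x ω|) ≠ 0 := by positivity
        field_simp

/-- The filter basis of `0` in `L⁰` formed by the balls with random radius in `L⁰₊₊`. -/
@[reducible] def l0Basis : RingFilterBasis (L0 P) where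
  sets := {U | ∃ ε : L0 P, StrictPos ε ∧ U = ball0 ε}
  nonempty := by
    refine ⟨_, 1, ?_, rfl⟩
    filter_upwards [(AEEqFun.coeFn_one : ⇑(1 : L0 P) =ᵐ[P] 1)] with ω h
    simp [h]
  inter_sets := by
    rintro _ _ ⟨ε, hε, rfl⟩ ⟨η, hη, rfl⟩
    refine ⟨_, ⟨ε ⊓ η, ?_, rfl⟩, fun n hn =>
      ⟨le_trans (show |n| ≤ ε ⊓ η from hn) inf_le_left,
        le_trans (show |n| ≤ ε ⊓ η from hn) inf_le_right⟩⟩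
    filter_upwards [hε, hη, AEEqFun.coeFn_inf ε η] with ω h1 h2 h3
    rw [h3]
    exact lt_inf_iff.2 ⟨h1, h2⟩
  zero' := by
    rintro _ ⟨ε, hε, rfl⟩
    rw [mem_ball0]
    filter_upwards [hε, (AEEqFun.coeFn_zero : ⇑(0 : L0 P) =ᵐ[P] 0)] with ω h1 h2
    rw [h2]
    simpa using h1.le
  add' := by
    rintro _ ⟨ε, hε, rfl⟩
    obtain ⟨δ, hδ, he⟩ := exists_strictPos 0 hε (fun _ b => b / 2)
      (by exact continuous_snd.div_const 2) (fun a b hb => by positivity)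
    refine ⟨_, ⟨δ, hδ, rfl⟩, ?_⟩
    rintro _ ⟨a, ha, b, hb, rfl⟩
    rw [mem_ball0] at ha hb ⊢
    filter_upwards [ha, hb, he, AEEqFun.coeFn_add a b] with ω h1 h2 h3 h4
    simp only [h4, Pi.add_apply]
    calc |a ω + b ω| ≤ |a ω| + |b ω| := abs_add_le _ _
      _ ≤ ε ω := by rw [h3] at h1 h2; linarith
  neg' := by
    rintro _ ⟨ε, hε, rfl⟩
    refine ⟨_, ⟨ε, hε, rfl⟩, fun n hn => ?_⟩
    rw [Set.mem_preimage, mem_ball0]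
    rw [mem_ball0] at hn
    filter_upwards [hn, AEEqFun.coeFn_neg n] with ω h1 h2
    rw [h2]
    simpa using h1
  conj' := by
    rintro x _ ⟨ε, hε, rfl⟩
    refine ⟨_, ⟨ε, hε, rfl⟩, fun n hn => ?_⟩
    simpa using hn
  mul' := by
    rintro _ ⟨ε, hε, rfl⟩
    obtain ⟨δ, hδ, he⟩ := exists_strictPos 0 hε (fun _ b => min 1 b)
      (by exact continuous_const.min continuous_snd) (fun a b hb => lt_min one_pos hb)
    refine ⟨_, ⟨δ, hδ, rfl⟩, ?_⟩
    rintro _ ⟨a, ha, b, hb, rfl⟩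
    rw [mem_ball0] at ha hb ⊢
    filter_upwards [ha, hb, he, AEEqFun.coeFn_mul a b] with ω h1 h2 h3 h4
    simp only [h4, Pi.mul_apply]
    rw [h3] at h1 h2
    rw [abs_mul]
    calc |a ω| * |b ω| ≤ 1 * |b ω| :=
          mul_le_mul_of_nonneg_right (h1.trans (min_le_left _ _)) (abs_nonneg _)
      _ ≤ ε ω := by rw [one_mul]; exact h2.trans (min_le_right _ _)
  mul_left' := by
    rintro x _ ⟨ε, hε, rfl⟩
    obtain ⟨δ, hδ, h⟩ := exists_ball_mul x hε
    exact ⟨_, ⟨δ, hδ, rfl⟩, fun n hn => h n hn⟩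
  mul_right' := by
    rintro x _ ⟨ε, hε, rfl⟩
    obtain ⟨δ, hδ, h⟩ := exists_ball_mul x hε
    exact ⟨_, ⟨δ, hδ, rfl⟩, fun n hn => by
      rw [Set.mem_preimage, mul_comm]
      exact h n hn⟩

/-- The topology on `L⁰` in which the balls `{n : |m - n| ≤ ε}`, `ε ∈ L⁰₊₊`, form a
neighbourhood base of `m`. -/
instance instTopologicalSpaceL0 : TopologicalSpace (L0 P) := l0Basis.topology

instance instIsTopologicalRingL0 : IsTopologicalRing (L0 P) := l0Basis.isTopologicalRing

theorem nhds_zero_hasBasis_L0 :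
    (𝓝 (0 : L0 P)).HasBasis StrictPos ball0 := by
  have h := (l0Basis (P := P)).toAddGroupFilterBasis.nhds_zero_hasBasis
  refine ⟨fun t => (h.mem_iff).trans ?_⟩
  constructor
  · rintro ⟨_, ⟨ε, hε, rfl⟩, ht⟩
    exact ⟨ε, hε, ht⟩
  · rintro ⟨ε, hε, ht⟩
    exact ⟨_, ⟨ε, hε, rfl⟩, ht⟩

/-- The inclusion of `L⁰` into the extended random variables. -/
def toExt (m : L0 P) : ExtL0 P :=
  AEEqFun.comp (fun r : ℝ => (r : EReal)) continuous_coe_real_ereal m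

/-- The indicator `1_A` of an event, as an element of `L⁰`. -/
def ind (P : Measure Ω) (A : Set Ω) (hA : MeasurableSet A) : L0 P :=
  AEEqFun.mk (A.indicator fun _ => (1 : ℝ))
    (stronglyMeasurable_const.indicator hA).aestronglyMeasurable

/-- Countable measurable partitions of `Ω` (members may be empty). -/
structure EventPartition (Ω : Type*) [MeasurableSpace Ω] where
  set : ℕ → Set Ω
  measurable : ∀ i, MeasurableSet (set i)
  disjoint : Pairwise fun i j => Disjoint (set i) (set j)
  cover : ⋃ i, set i = Set.univ

variable {E : Type*} [AddCommGroup E] [Module (L0 P) E]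

variable (P) in
/-- `Y = ∑ 1_{A_i} X_i`. -/
def IsConcat (A : EventPartition Ω) (X : ℕ → E) (Y : E) : Prop :=
  ∀ i, ind P (A.set i) (A.measurable i) • Y = ind P (A.set i) (A.measurable i) • X i

variable (P) in
/-- `C` contains every `∑ 1_{A_i} X_i` with `X_i ∈ C`. -/
def SigmaStable (C : Set E) : Prop :=
  ∀ (A : EventPartition Ω) (X : ℕ → E), (∀ i, X i ∈ C) → ∀ Y, IsConcat P A X Y → Y ∈ C

variable (P) in
def L0Convex (C : Set E) : Prop :=
  ∀ l : L0 P, 0 ≤ l → l ≤ 1 → ∀ X ∈ C, ∀ Y ∈ C, l • X + (1 - l) • Y ∈ C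

variable (P) in
def L0Absorbent (U : Set E) : Prop :=
  ∀ X : E, ∃ l : L0 P, StrictPos l ∧ ∃ u ∈ U, X = l • u

variable (P) in
def L0Balanced (U : Set E) : Prop :=
  ∀ l : L0 P, |l| ≤ 1 → ∀ X ∈ U, l • X ∈ U

variable (P) in
/-- `∑ 1_{A_i} U_i` for a sequence of sets. -/
def concatSets (A : EventPartition Ω) (U : ℕ → Set E) : Set E :=
  {Y | ∃ X : ℕ → E, (∀ i, X i ∈ U i) ∧ IsConcat P A X Y}

variable (P E) in
/-- A topological `L⁰`-module is a conditional locally convex module if every countable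
concatenation `∑ 1_{A_i} X_i` is a well-defined element, the topology has a base of neighbourhoods
of `0` made of `L⁰`-convex, `L⁰`-absorbent, `L⁰`-balanced and `σ`-stable sets, and the collection
of all neighbourhoods of `0` is stable under countable concatenation. -/
structure CondLocallyConvex [TopologicalSpace E] [IsTopologicalAddGroup E]
    [ContinuousSMul (L0 P) E] : Prop where
  existsUnique_concat : ∀ (A : EventPartition Ω) (X : ℕ → E), ∃! Y, IsConcat P A X Y
  exists_nhds : ∀ U ∈ 𝓝 (0 : E), ∃ V ∈ 𝓝 (0 : E), V ⊆ U ∧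
    L0Convex P V ∧ L0Absorbent P V ∧ L0Balanced P V ∧ SigmaStable P V
  concat_nhds : ∀ (A : EventPartition Ω) (U : ℕ → Set E), (∀ i, U i ∈ 𝓝 (0 : E)) →
    concatSets P A U ∈ 𝓝 (0 : E)

variable (P) in
/-- `L⁰`-convex cones containing `0`. -/
structure IsL0ConvexCone (K : Set E) : Prop where
  zero_mem : (0 : E) ∈ K
  convex : L0Convex P K
  smul_mem : ∀ l : L0 P, StrictPos l → ∀ X ∈ K, l • X ∈ K

/-- `C + K = C`. -/
def MonotoneSet (K C : Set E) : Prop := Set.image2 (fun X Y => X + Y) C K = C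

variable (P) in
/-- There is no event `A` of positive probability with `1_A C = 1_A E`. -/
def NowhereFull (C : Set E) : Prop :=
  ∀ (A : Set Ω) (hA : MeasurableSet A), 0 < P A →
    ∃ X : E, ∀ Y ∈ C, ind P A hA • Y ≠ ind P A hA • X

variable [TopologicalSpace E]

variable (P) in
/-- The polar cone `K°` in the `L⁰`-dual. `WeakDual (L0 P) E` is the `L⁰`-module of continuous
`L⁰`-linear maps `E → L⁰`, with the coarsest topology making all evaluations continuous. -/
def polarCone (K : Set E) : Set (WeakDual (L0 P) E) := {f | ∀ X ∈ K, 0 ≤ f X}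

/-- Local functions on `S`: `π (1_A f + 1_{Aᶜ} g) = 1_A π f + 1_{Aᶜ} π g`. -/
def LocalOn (S : Set (WeakDual (L0 P) E)) (p : WeakDual (L0 P) E → ExtL0 P) : Prop :=
  ∀ (A : Set Ω) (hA : MeasurableSet A), ∀ f ∈ S, ∀ g ∈ S,
    ∀ᵐ ω ∂P, (ω ∈ A → p (ind P A hA • f + ind P Aᶜ hA.compl • g) ω = p f ω) ∧
      (ω ∉ A → p (ind P A hA • f + ind P Aᶜ hA.compl • g) ω = p g ω)

def PosHomogeneousOn (S : Set (WeakDual (L0 P) E)) (p : WeakDual (L0 P) E → ExtL0 P) : Prop :=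
  ∀ l : L0 P, StrictPos l → ∀ f ∈ S, ∀ᵐ ω ∂P, p (l • f) ω = (l ω : EReal) * p f ω

/-- `L⁰`-concavity, with the conventions `∞ - ∞ = -∞` and `0 · (±∞) = 0` of `EReal`. -/
def L0ConcaveOn (S : Set (WeakDual (L0 P) E)) (p : WeakDual (L0 P) E → ExtL0 P) : Prop :=
  ∀ l : L0 P, 0 ≤ l → l ≤ 1 → ∀ f ∈ S, ∀ g ∈ S,
    ∀ᵐ ω ∂P, (l ω : EReal) * p f ω + ((1 - l ω : ℝ) : EReal) * p g ω ≤
      p (l • f + (1 - l) • g) ω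

def MaximalInvariantOn (S : Set (WeakDual (L0 P) E)) (p : WeakDual (L0 P) E → ExtL0 P) : Prop :=
  (∃ f ∈ S, ∀ᵐ ω ∂P, p f ω = ⊤) → ∀ g ∈ S, ∀ᵐ ω ∂P, p g ω = ⊤

/-- All upper level sets are closed in `S`, for the weak topology. -/
def UpperSemicontOn (S : Set (WeakDual (L0 P) E)) (p : WeakDual (L0 P) E → ExtL0 P) : Prop :=
  ∀ m : ExtL0 P, IsClosed {f : S | m ≤ p f}

/-- The properties required of `π` on the polar cone. -/
structure IsPenaltyOn (S : Set (WeakDual (L0 P) E)) (p : WeakDual (L0 P) E → ExtL0 P) :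
    Prop where
  isLocal : LocalOn S p
  posHomogeneous : PosHomogeneousOn S p
  concave : L0ConcaveOn S p
  maximalInvariant : MaximalInvariantOn S p
  upperSemicont : UpperSemicontOn S p

/-- `X ∈ C` if and only if `⟨f, X⟩ ≥ π f` for all `f ∈ S`. -/
def Represents (S : Set (WeakDual (L0 P) E)) (p : WeakDual (L0 P) E → ExtL0 P) (C : Set E) :
    Prop :=
  ∀ X : E, X ∈ C ↔ ∀ f ∈ S, p f ≤ toExt (f X)

end

end CondModule

/-!
Hahn–Banach over `L⁰`: below an `L⁰`-sublinear map there is a minimal one, and minimal ones are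
linear. Strict separation needs more than `X ∉ S`: for σ-stable `S`, exhausting by the events on
which `X` agrees with a point of `S` leaves an event of positive measure on no part of which it
does, and there the gauge forces the separating form to have a positive gap. Separating points
from `C` in this way shows that the essential infimum represents `C`.

For uniqueness, let `q` represent `C`. Then `q ≤ p` is immediate. If `q f₀` is not above `s`, where
`s ≤ ⟨f₀, c⟩` for all `c ∈ C`, then by upper semicontinuity finitely many evaluations detect this,
so `(f₀, s)` can be separated from the hypograph of `q` already in a finite power of `L⁰`. Since the
hypograph is a cone, the separation amounts to `X` and `r ≥ 0` with `r q ≤ ⟨·, X⟩` but not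
`r s ≤ ⟨f₀, X⟩`. Hence `(1 + n r)⁻¹ (c + n X) ∈ C` for `c ∈ C` and every `n`; evaluating `f₀` there
gives `n (r s - ⟨f₀, X⟩) ≤ ⟨f₀, c⟩ - s` for all `n`, a contradiction.
-/

namespace CondModule

open Pointwise

noncomputable section

variable {Ω : Type*} [MeasurableSpace Ω] {P : Measure Ω}

theorem le_iff_ae {β : Type*} [TopologicalSpace β] [Preorder β] {a b : Ω →ₘ[P] β} :
    a ≤ b ↔ ∀ᵐ ω ∂P, a ω ≤ b ω :=
  AEEqFun.coeFn_le.symm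

theorem exists_ae_eq_of_measurable {β : Type*} [TopologicalSpace β]
    [TopologicalSpace.PseudoMetrizableSpace β] [SecondCountableTopology β] [MeasurableSpace β]
    [OpensMeasurableSpace β] {g : Ω → β} (hg : Measurable g) :
    ∃ a : Ω →ₘ[P] β, ∀ᵐ ω ∂P, a ω = g ω :=
  ⟨AEEqFun.mk g hg.aestronglyMeasurable, AEEqFun.coeFn_mk _ _⟩

theorem ae_add (a b : L0 P) : ∀ᵐ ω ∂P, (a + b) ω = a ω + b ω := AEEqFun.coeFn_add a b

theorem ae_mul (a b : L0 P) : ∀ᵐ ω ∂P, (a * b) ω = a ω * b ω := AEEqFun.coeFn_mul a b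

theorem ae_sub (a b : L0 P) : ∀ᵐ ω ∂P, (a - b) ω = a ω - b ω := AEEqFun.coeFn_sub a b

theorem ae_zero : ∀ᵐ ω ∂P, (0 : L0 P) ω = 0 := AEEqFun.coeFn_zero

theorem ae_one : ∀ᵐ ω ∂P, (1 : L0 P) ω = 1 := AEEqFun.coeFn_one

theorem ae_const (c : ℝ) : ∀ᵐ ω ∂P, (AEEqFun.const Ω c : L0 P) ω = c := AEEqFun.coeFn_const Ω c

theorem ae_abs (a : L0 P) : ∀ᵐ ω ∂P, |a| ω = |a ω| := AEEqFun.coeFn_abs a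

theorem ae_toExt (a : L0 P) : ∀ᵐ ω ∂P, toExt a ω = (a ω : EReal) := AEEqFun.coeFn_comp _ _ a

theorem ae_ind (A : Set Ω) (hA : MeasurableSet A) :
    ∀ᵐ ω ∂P, ind P A hA ω = A.indicator (fun _ => 1) ω :=
  AEEqFun.coeFn_mk _ _

theorem zero_le_iff_ae {a : L0 P} : 0 ≤ a ↔ ∀ᵐ ω ∂P, 0 ≤ a ω := by
  rw [le_iff_ae]
  refine eventually_congr ?_
  filter_upwards [ae_zero (P := P)] with ω h
  rw [h]

instance instIsOrderedAddMonoidL0 : IsOrderedAddMonoid (L0 P) where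
  add_le_add_left a b h c := by
    rw [le_iff_ae] at h ⊢
    filter_upwards [h, ae_add a c, ae_add b c] with ω h h1 h2
    rw [h1, h2]
    exact add_le_add_left h _

instance instZeroLEOneClassL0 : ZeroLEOneClass (L0 P) where
  zero_le_one := by
    rw [zero_le_iff_ae]
    filter_upwards [ae_one (P := P)] with ω h
    rw [h]
    exact zero_le_one

instance instIsOrderedRingL0 : IsOrderedRing (L0 P) :=
  .of_mul_nonneg fun a b ha hb => by
    rw [zero_le_iff_ae] at ha hb ⊢
    filter_upwards [ha, hb, ae_mul a b] with ω ha hb h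
    rw [h]
    exact mul_nonneg ha hb

theorem abs_mul_L0 (a b : L0 P) : |a * b| = |a| * |b| := by
  apply AEEqFun.ext
  filter_upwards [ae_abs (a * b), ae_mul a b, ae_abs a, ae_abs b, ae_mul |a| |b|]
    with ω h1 h2 h3 h4 h5
  rw [h1, h2, h5, h3, h4, abs_mul]

theorem nonneg_of_forall_le_nsmul {a c : L0 P} (h : ∀ n : ℕ, a ≤ n • c) : 0 ≤ c := by
  have hsmul : ∀ n : ℕ, ∀ᵐ ω ∂P, (n • c) ω = n * c ω := by
    intro n
    induction n with
    | zero => simpa using ae_zero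
    | succ n ih =>
      filter_upwards [ih, ae_add (n • c) c] with ω h1 h2
      rw [succ_nsmul, h2, h1]
      push_cast
      ring
  rw [zero_le_iff_ae]
  filter_upwards [ae_all_iff.2 fun n => le_iff_ae.1 (h n), ae_all_iff.2 hsmul] with ω h1 h2
  by_contra! hneg
  obtain ⟨n, hn⟩ := exists_lt_nsmul (neg_pos.2 hneg) (-a ω)
  have := h1 n
  rw [h2 n] at this
  rw [nsmul_eq_mul] at hn
  linarith

theorem StrictPos.nonneg {a : L0 P} (h : StrictPos a) : 0 ≤ a :=
  zero_le_iff_ae.2 (h.mono fun _ => le_of_lt)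

theorem StrictPos.add_nonneg {a b : L0 P} (ha : StrictPos a) (hb : 0 ≤ b) :
    StrictPos (a + b) := by
  filter_upwards [ha, zero_le_iff_ae.1 hb, ae_add a b] with ω h1 h2 h3
  rw [h3]
  exact add_pos_of_pos_of_nonneg h1 h2

theorem StrictPos.mul {a b : L0 P} (ha : StrictPos a) (hb : StrictPos b) : StrictPos (a * b) := by
  filter_upwards [ha, hb, ae_mul a b] with ω h1 h2 h3
  rw [h3]
  exact mul_pos h1 h2

theorem StrictPos.exists_mul_eq_one {a : L0 P} (h : StrictPos a) :
    ∃ b : L0 P, StrictPos b ∧ b * a = 1 := by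
  obtain ⟨b, hb⟩ := exists_ae_eq_of_measurable (P := P) a.measurable.inv
  refine ⟨b, ?_, AEEqFun.ext ?_⟩
  · filter_upwards [h, hb] with ω h hb
    rw [hb]
    exact inv_pos.2 h
  · filter_upwards [h, hb, ae_one (P := P), ae_mul b a] with ω h hb h1 h2
    rw [h1, h2, hb]
    exact inv_mul_cancel₀ h.ne'

theorem strictPos_one : StrictPos (1 : L0 P) := by
  filter_upwards [ae_one (P := P)] with ω h
  rw [h]
  exact one_pos

theorem strictPos_const {c : ℝ} (hc : 0 < c) : StrictPos (AEEqFun.const Ω c : L0 P) := by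
  filter_upwards [ae_const (P := P) c] with ω h
  rw [h]
  exact hc

theorem nhds_hasBasis_L0 (a : L0 P) :
    (𝓝 a).HasBasis StrictPos fun ε => {b | |b - a| ≤ ε} := by
  have h := (nhds_zero_hasBasis_L0 (P := P)).comap (· - a)
  rwa [nhds_translation_sub] at h

theorem mem_closure_L0_iff {S : Set (L0 P)} {a : L0 P} :
    a ∈ closure S ↔ ∀ ε, StrictPos ε → ∃ b ∈ S, |b - a| ≤ ε :=
  mem_closure_iff_nhds_basis (nhds_hasBasis_L0 a)

theorem ind_nonneg (A : Set Ω) (hA : MeasurableSet A) : 0 ≤ ind P A hA := by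
  rw [zero_le_iff_ae]
  filter_upwards [ae_ind (P := P) A hA] with ω h
  rw [h]
  exact Set.indicator_nonneg (fun _ _ => zero_le_one) ω

theorem ind_compl (A : Set Ω) (hA : MeasurableSet A) :
    ind P Aᶜ hA.compl = 1 - ind P A hA := by
  apply AEEqFun.ext
  filter_upwards [ae_ind (P := P) A hA, ae_ind (P := P) Aᶜ hA.compl, ae_one (P := P),
    ae_sub 1 (ind P A hA)] with ω h1 h2 h3 h4
  rw [h4, h3, h2, h1]
  by_cases hω : ω ∈ A <;> simp [hω]

theorem ind_mul_ind {A B : Set Ω} (hA : MeasurableSet A) (hB : MeasurableSet B) :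
    ind P A hA * ind P B hB = ind P (A ∩ B) (hA.inter hB) := by
  apply AEEqFun.ext
  filter_upwards [ae_ind (P := P) A hA, ae_ind (P := P) B hB, ae_mul (ind P A hA) (ind P B hB),
    ae_ind (P := P) (A ∩ B) (hA.inter hB)] with ω h1 h2 h3 h4
  rw [h3, h2, h1, h4, ← Set.inter_indicator_mul, one_mul]

theorem ind_mul_ind_of_subset {A B : Set Ω} (hA : MeasurableSet A) (hB : MeasurableSet B)
    (h : A ⊆ B) : ind P A hA * ind P B hB = ind P A hA := by
  simp only [ind_mul_ind, Set.inter_eq_left.2 h]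

theorem ind_mul_self (A : Set Ω) (hA : MeasurableSet A) :
    ind P A hA * ind P A hA = ind P A hA :=
  ind_mul_ind_of_subset hA hA subset_rfl

theorem ind_le_one (A : Set Ω) (hA : MeasurableSet A) : ind P A hA ≤ 1 := by
  rw [← sub_nonneg, ← ind_compl]
  exact ind_nonneg _ _

theorem ind_eq_zero_iff {A : Set Ω} (hA : MeasurableSet A) : ind P A hA = 0 ↔ P A = 0 := by
  rw [measure_eq_zero_iff_ae_notMem, AEEqFun.ext_iff]
  refine eventually_congr ?_
  filter_upwards [ae_ind (P := P) A hA, ae_zero (P := P)] with ω h1 h2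
  rw [h1, h2]
  simp

theorem ind_mul_eq_ind_mul_iff {A : Set Ω} (hA : MeasurableSet A) {a b : L0 P} :
    ind P A hA * a = ind P A hA * b ↔ ∀ᵐ ω ∂P, ω ∈ A → a ω = b ω := by
  rw [AEEqFun.ext_iff]
  refine eventually_congr ?_
  filter_upwards [ae_ind (P := P) A hA, ae_mul (ind P A hA) a, ae_mul (ind P A hA) b]
    with ω h1 h2 h3
  rw [h2, h3, h1]
  by_cases hω : ω ∈ A <;> simp [hω]

section

variable {E : Type*} [AddCommGroup E] [Module (L0 P) E]

theorem ind_smul_add_ind_compl_smul {A : Set Ω} (hA : MeasurableSet A) (x : E) :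
    ind P A hA • x + ind P Aᶜ hA.compl • x = x := by
  rw [← add_smul, ind_compl A hA, add_sub_cancel, one_smul]

theorem ind_smul_ind_compl_smul {A : Set Ω} (hA : MeasurableSet A) (x : E) :
    ind P A hA • ind P Aᶜ hA.compl • x = 0 := by
  rw [smul_smul, ind_compl A hA, mul_sub, mul_one, ind_mul_self, sub_self, zero_smul]

theorem ind_smul_ind_smul {A : Set Ω} (hA : MeasurableSet A) (x : E) :
    ind P A hA • ind P A hA • x = ind P A hA • x := by
  rw [smul_smul, ind_mul_self]

theorem ind_smul_concat {A : Set Ω} (hA : MeasurableSet A) (x y : E) :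
    ind P A hA • (ind P A hA • x + ind P Aᶜ hA.compl • y) = ind P A hA • x := by
  rw [smul_add, ind_smul_ind_smul, ind_smul_ind_compl_smul, add_zero]

theorem ind_compl_smul_concat {A : Set Ω} (hA : MeasurableSet A) (x y : E) :
    ind P Aᶜ hA.compl • (ind P A hA • x + ind P Aᶜ hA.compl • y) = ind P Aᶜ hA.compl • y := by
  rw [smul_add, smul_comm, ind_smul_ind_compl_smul, zero_add, ind_smul_ind_smul]

theorem ind_smul_eq_of_subset {A B : Set Ω} (hA : MeasurableSet A) (hB : MeasurableSet B)
    (h : A ⊆ B) {x y : E} (hxy : ind P B hB • x = ind P B hB • y) :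
    ind P A hA • x = ind P A hA • y := by
  rw [← ind_mul_ind_of_subset hA hB h, mul_smul, mul_smul, hxy]

end

theorem toExt_le_toExt {a b : L0 P} : toExt a ≤ toExt b ↔ a ≤ b := by
  rw [le_iff_ae, le_iff_ae]
  refine eventually_congr ?_
  filter_upwards [ae_toExt a, ae_toExt b] with ω h1 h2
  rw [h1, h2, EReal.coe_le_coe_iff]

theorem exists_toExt_eq {m : ExtL0 P} (hbot : ∀ᵐ ω ∂P, m ω ≠ ⊥) (htop : ∀ᵐ ω ∂P, m ω ≠ ⊤) :
    ∃ c : L0 P, toExt c = m := by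
  obtain ⟨c, hc⟩ := exists_ae_eq_of_measurable (P := P) m.measurable.ereal_toReal
  refine ⟨c, AEEqFun.ext ?_⟩
  filter_upwards [hc, ae_toExt c, hbot, htop] with ω h1 h2 h3 h4
  rw [h2, h1, EReal.coe_toReal h4 h3]

theorem toExt_le_of_forall_sub_le {s : L0 P} {m : ExtL0 P}
    (h : ∀ δ, StrictPos δ → toExt (s - δ) ≤ m) : toExt s ≤ m := by
  let δ : ℕ → L0 P := fun n => AEEqFun.const Ω (1 / ((n : ℝ) + 1))
  have hδ : ∀ᵐ ω ∂P, ∀ n : ℕ, ((s ω - 1 / ((n : ℝ) + 1) : ℝ) : EReal) ≤ m ω := by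
    rw [ae_all_iff]
    intro n
    filter_upwards [le_iff_ae.1 (h (δ n) (strictPos_const Nat.one_div_pos_of_nat)),
      ae_toExt (s - δ n), ae_sub s (δ n), ae_const (1 / ((n : ℝ) + 1))] with ω h1 h2 h3 h4
    rwa [h2, h3, h4] at h1
  rw [le_iff_ae]
  filter_upwards [hδ, ae_toExt s] with ω h1 h2
  rw [h2]
  have hlim : Tendsto (fun n : ℕ => s ω - 1 / ((n : ℝ) + 1)) atTop (𝓝 (s ω)) := by
    simpa using tendsto_const_nhds.sub (tendsto_one_div_add_atTop_nhds_zero_nat (𝕜 := ℝ))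
  exact le_of_tendsto' ((continuous_coe_real_ereal.tendsto _).comp hlim) h1

theorem le_toExt_of_forall_le_add {s : L0 P} {m : ExtL0 P}
    (h : ∀ δ, StrictPos δ → m ≤ toExt (s + δ)) : m ≤ toExt s := by
  let δ : ℕ → L0 P := fun n => AEEqFun.const Ω (1 / ((n : ℝ) + 1))
  have hδ : ∀ᵐ ω ∂P, ∀ n : ℕ, m ω ≤ ((s ω + 1 / ((n : ℝ) + 1) : ℝ) : EReal) := by
    rw [ae_all_iff]
    intro n
    filter_upwards [le_iff_ae.1 (h (δ n) (strictPos_const Nat.one_div_pos_of_nat)),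
      ae_toExt (s + δ n), ae_add s (δ n), ae_const (1 / ((n : ℝ) + 1))] with ω h1 h2 h3 h4
    rwa [h2, h3, h4] at h1
  rw [le_iff_ae]
  filter_upwards [hδ, ae_toExt s] with ω h1 h2
  rw [h2]
  have hlim : Tendsto (fun n : ℕ => s ω + 1 / ((n : ℝ) + 1)) atTop (𝓝 (s ω)) := by
    simpa using tendsto_const_nhds.add (tendsto_one_div_add_atTop_nhds_zero_nat (𝕜 := ℝ))
  exact ge_of_tendsto' ((continuous_coe_real_ereal.tendsto _).comp hlim) h1

theorem isClosed_le_toExt (m : ExtL0 P) : IsClosed {a : L0 P | m ≤ toExt a} := by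
  refine isClosed_of_closure_subset fun a ha => le_toExt_of_forall_le_add fun δ hδ => ?_
  obtain ⟨b, hb, hba⟩ := mem_closure_L0_iff.1 ha δ hδ
  exact hb.trans (toExt_le_toExt.2 (sub_le_iff_le_add'.1 (abs_le'.1 hba).1))

theorem exists_countable_ae_cover [SFinite P] {ι : Type*} (S : Set ι) {A : ι → Set Ω}
    (hA : ∀ i ∈ S, MeasurableSet (A i)) :
    ∃ t ⊆ S, t.Countable ∧ ∀ i ∈ S, A i ≤ᵐ[P] ⋃ j ∈ t, A j := by
  let T : Set ENNReal := (fun t : Set ι => P.toFinite (⋃ j ∈ t, A j)) '' {t | t ⊆ S ∧ t.Countable}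
  have hT : T.Nonempty := ⟨_, ∅, ⟨S.empty_subset, Set.countable_empty⟩, rfl⟩
  obtain ⟨u, -, hu, huT⟩ := exists_seq_tendsto_sSup hT (OrderTop.bddAbove T)
  choose r hr hru using huT
  have hsub : ⋃ n, r n ⊆ S := Set.iUnion_subset fun n => (hr n).1
  have hcount : (⋃ n, r n).Countable := Set.countable_iUnion fun n => (hr n).2
  have hmax : sSup T ≤ P.toFinite (⋃ j ∈ ⋃ n, r n, A j) := le_of_tendsto' hu fun n => by
    rw [← hru n]
    exact measure_mono (Set.biUnion_subset_biUnion_left (Set.subset_iUnion r n))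
  refine ⟨⋃ n, r n, hsub, hcount, fun i hi => ?_⟩
  have hinsert : P.toFinite (A i ∪ ⋃ j ∈ ⋃ n, r n, A j) ≤ sSup T :=
    le_sSup ⟨insert i (⋃ n, r n), ⟨Set.insert_subset hi hsub, hcount.insert i⟩, by
      simp only [Set.biUnion_insert]⟩
  have hmeas : MeasurableSet (⋃ j ∈ ⋃ n, r n, A j) :=
    MeasurableSet.biUnion hcount fun j hj => hA j (hsub hj)
  rw [← ae_toFinite (μ := P)]
  exact Set.subset_union_left.eventuallyLE.trans_eq
    (ae_eq_of_subset_of_measure_ge Set.subset_union_right (hinsert.trans hmax)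
      hmeas.nullMeasurableSet (measure_ne_top _ _)).symm

theorem exists_ae_greatest_of_iUnion_mem [SFinite P] {𝓑 : Set (Set Ω)} (hne : 𝓑.Nonempty)
    (hmeas : ∀ B ∈ 𝓑, MeasurableSet B)
    (hUnion : ∀ B : ℕ → Set Ω, (∀ n, B n ∈ 𝓑) → ⋃ n, B n ∈ 𝓑) :
    ∃ B ∈ 𝓑, ∀ B' ∈ 𝓑, B' ≤ᵐ[P] B := by
  obtain ⟨t, ht, htc, hcover⟩ := exists_countable_ae_cover (P := P) 𝓑 (A := id) hmeas
  rcases t.eq_empty_or_nonempty with rfl | htne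
  · obtain ⟨B, hB⟩ := hne
    refine ⟨B, hB, fun B' hB' => (hcover B' hB').trans ?_⟩
    rw [Set.biUnion_empty]
    exact (Set.empty_subset B).eventuallyLE
  · obtain ⟨s, rfl⟩ := htc.exists_eq_range htne
    refine ⟨⋃ n, s n, hUnion s fun n => ht (Set.mem_range_self n), fun B' hB' => ?_⟩
    simpa using hcover B' hB'

theorem exists_countable_ae_iInf_le [SFinite P] (S : Set (ExtL0 P)) :
    ∃ t ⊆ S, t.Countable ∧ ∀ a ∈ S, ∀ᵐ ω ∂P, ⨅ b ∈ t, b ω ≤ a ω := by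
  choose t hsub hcount hcover using fun q : ℚ =>
    exists_countable_ae_cover (P := P) S (A := fun b => {ω | b ω < ((q : ℝ) : EReal)})
      fun b _ => measurableSet_lt b.measurable measurable_const
  refine ⟨⋃ q, t q, Set.iUnion_subset hsub, Set.countable_iUnion hcount, fun a ha => ?_⟩
  filter_upwards [ae_all_iff.2 fun q => hcover q a ha] with ω hω
  refine le_of_forall_gt fun c hc => ?_
  obtain ⟨q, haq, hqc⟩ := EReal.lt_iff_exists_rat_btwn.1 hc
  obtain ⟨b, hb, hbq⟩ := Set.mem_iUnion₂.1 (hω q haq)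
  exact (biInf_le (fun b : ExtL0 P => b ω) (Set.mem_iUnion_of_mem q hb)).trans_lt (hbq.trans hqc)

theorem exists_isGLB_ExtL0 [SFinite P] (S : Set (ExtL0 P)) : ∃ m, IsGLB S m := by
  obtain ⟨t, hsub, hcount, hle⟩ := exists_countable_ae_iInf_le S
  obtain ⟨m, hm⟩ := exists_ae_eq_of_measurable (P := P)
    (Measurable.biInf t hcount fun b _ => b.measurable)
  refine ⟨m, fun a ha => ?_, fun c hc => ?_⟩
  · rw [le_iff_ae]
    filter_upwards [hm, hle a ha] with ω h1 h2
    rwa [h1]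
  · rw [le_iff_ae]
    filter_upwards [hm, (ae_ball_iff hcount).2 fun b hb => le_iff_ae.1 (hc (hsub hb))]
      with ω h1 h2
    rw [h1]
    exact le_iInf₂ h2

theorem exists_isGLB_L0 [SFinite P] {S : Set (L0 P)} (hne : S.Nonempty) (hbdd : BddBelow S) :
    ∃ c, IsGLB S c := by
  obtain ⟨a, ha⟩ := hne
  obtain ⟨b, hb⟩ := hbdd
  obtain ⟨m, hm⟩ := exists_isGLB_ExtL0 (toExt '' S)
  have hbm : toExt b ≤ m := hm.2 (Set.forall_mem_image.2 fun c hc => toExt_le_toExt.2 (hb hc))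
  have hma : m ≤ toExt a := hm.1 ⟨a, ha, rfl⟩
  obtain ⟨c, rfl⟩ : ∃ c, toExt c = m := by
    refine exists_toExt_eq ?_ ?_
    · filter_upwards [le_iff_ae.1 hbm, ae_toExt b] with ω h1 h2
      exact ((EReal.bot_lt_coe _).trans_le (h2 ▸ h1)).ne'
    · filter_upwards [le_iff_ae.1 hma, ae_toExt a] with ω h1 h2
      exact ((h2 ▸ h1).trans_lt (EReal.coe_lt_top _)).ne
  exact ⟨c, fun x hx => toExt_le_toExt.1 (hm.1 ⟨x, hx, rfl⟩), fun x hx =>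
    toExt_le_toExt.1 (hm.2 (Set.forall_mem_image.2 fun y hy => toExt_le_toExt.2 (hx hy)))⟩

section

variable {M : Type*} [AddCommGroup M] [Module (L0 P) M]

/-- Conditional sublinearity of `q : M → L⁰`. Homogeneity is only required for strictly positive
factors and only as an inequality; equality follows by inverting the factor. -/
structure L0Sublinear (q : M → L0 P) : Prop where
  add_le : ∀ x y, q (x + y) ≤ q x + q y
  smul_le : ∀ t : L0 P, StrictPos t → ∀ x, q (t • x) ≤ t * q x

namespace L0Sublinear

variable {q : M → L0 P}

theorem map_smul (hq : L0Sublinear q) {t : L0 P} (ht : StrictPos t) (x : M) :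
    q (t • x) = t * q x := by
  refine le_antisymm (hq.smul_le t ht x) ?_
  obtain ⟨b, hb, hbt⟩ := ht.exists_mul_eq_one
  calc t * q x = t * q (b • t • x) := by rw [smul_smul, hbt, one_smul]
    _ ≤ t * (b * q (t • x)) := mul_le_mul_of_nonneg_left (hq.smul_le b hb _) ht.nonneg
    _ = q (t • x) := by rw [← mul_assoc, mul_comm t, hbt, one_mul]

theorem map_zero (hq : L0Sublinear q) : q 0 = 0 := by
  have h := hq.map_smul (strictPos_one.add_nonneg zero_le_one) 0
  rwa [smul_zero, add_mul, one_mul, left_eq_add] at h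

theorem neg_map_neg_le (hq : L0Sublinear q) (x : M) : -q (-x) ≤ q x := by
  rw [neg_le_iff_add_nonneg, ← hq.map_zero, ← add_neg_cancel x]
  exact hq.add_le x (-x)

end L0Sublinear

theorem exists_sublinear_isGLB [SFinite P] {S : M → Set (L0 P)} (hne : ∀ x, (S x).Nonempty)
    (hbdd : ∀ x, BddBelow (S x))
    (hadd : ∀ x y, ∀ a ∈ S x, ∀ b ∈ S y, ∃ c ∈ S (x + y), c ≤ a + b)
    (hsmul : ∀ t, StrictPos t → ∀ x, ∀ a ∈ S x, ∃ c ∈ S (t • x), c ≤ t * a) :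
    ∃ q : M → L0 P, L0Sublinear q ∧ ∀ x, IsGLB (S x) (q x) := by
  choose q hq using fun x => exists_isGLB_L0 (hne x) (hbdd x)
  refine ⟨q, ⟨fun x y => ?_, fun t ht x => ?_⟩, hq⟩
  · rw [← sub_le_iff_le_add]
    refine (hq x).2 fun a ha => ?_
    rw [sub_le_comm]
    refine (hq y).2 fun b hb => ?_
    obtain ⟨c, hc, hcab⟩ := hadd x y a ha b hb
    rw [sub_le_iff_le_add']
    exact ((hq _).1 hc).trans hcab
  · obtain ⟨b, hb, hbt⟩ := ht.exists_mul_eq_one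
    have hle : b * q (t • x) ≤ q x := (hq x).2 fun a ha => by
      obtain ⟨c, hc, hcta⟩ := hsmul t ht x a ha
      calc b * q (t • x) ≤ b * (t * a) :=
            mul_le_mul_of_nonneg_left (((hq _).1 hc).trans hcta) hb.nonneg
        _ = a := by rw [← mul_assoc, hbt, one_mul]
    calc q (t • x) = t * (b * q (t • x)) := by rw [← mul_assoc, mul_comm t, hbt, one_mul]
      _ ≤ t * q x := mul_le_mul_of_nonneg_left hle ht.nonneg

namespace L0Sublinear

variable {q : M → L0 P}

theorem exists_le_map_neg_le [SFinite P] (hq : L0Sublinear q) (y : M) :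
    ∃ q' : M → L0 P, L0Sublinear q' ∧ q' ≤ q ∧ q' (-y) ≤ -q y := by
  let S : M → Set (L0 P) := fun x => {a | ∃ t, StrictPos t ∧ a = q (x + t • y) - t * q y}
  have hmem : ∀ x, q (x + (1 : L0 P) • y) - 1 * q y ∈ S x := fun x => ⟨1, strictPos_one, rfl⟩
  have hbdd : ∀ x, BddBelow (S x) := by
    refine fun x => ⟨-q (-x), ?_⟩
    rintro _ ⟨t, ht, rfl⟩
    have h := hq.add_le (x + t • y) (-x)
    rw [add_neg_cancel_comm, hq.map_smul ht] at h
    rw [le_sub_iff_add_le, neg_add_le_iff_le_add, add_comm]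
    exact h
  have hadd : ∀ x x', ∀ a ∈ S x, ∀ b ∈ S x', ∃ c ∈ S (x + x'), c ≤ a + b := by
    rintro x x' _ ⟨t, ht, rfl⟩ _ ⟨t', ht', rfl⟩
    refine ⟨_, ⟨t + t', ht.add_nonneg ht'.nonneg, rfl⟩, ?_⟩
    have h := hq.add_le (x + t • y) (x' + t' • y)
    rw [add_add_add_comm, ← add_smul] at h
    rw [sub_add_sub_comm, ← add_mul]
    exact sub_le_sub_right h _
  have hsmul : ∀ s, StrictPos s → ∀ x, ∀ a ∈ S x, ∃ c ∈ S (s • x), c ≤ s * a := by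
    rintro s hs x _ ⟨t, ht, rfl⟩
    refine ⟨_, ⟨s * t, hs.mul ht, rfl⟩, le_of_eq ?_⟩
    rw [mul_smul, ← smul_add, hq.map_smul hs, mul_sub, mul_assoc]
  obtain ⟨q', hq', hglb⟩ := exists_sublinear_isGLB (fun x => ⟨_, hmem x⟩) hbdd hadd hsmul
  refine ⟨q', hq', fun x => ((hglb x).1 (hmem x)).trans ?_, ((hglb (-y)).1 (hmem _)).trans ?_⟩
  · rw [one_smul, one_mul, sub_le_iff_le_add]
    exact hq.add_le x y
  · rw [one_smul, one_mul, neg_add_cancel, hq.map_zero, zero_sub]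

theorem exists_le_of_isChain [SFinite P] {c : Set (M → L0 P)} (hc : IsChain (· ≤ ·) c)
    (hsub : ∀ f ∈ c, L0Sublinear f) (hne : c.Nonempty) :
    ∃ q, L0Sublinear q ∧ ∀ f ∈ c, q ≤ f := by
  obtain ⟨g, hg⟩ := hne
  let S : M → Set (L0 P) := fun x => (fun f : M → L0 P => f x) '' c
  have hbdd : ∀ x, BddBelow (S x) := by
    refine fun x => ⟨-g (-x), ?_⟩
    rintro _ ⟨f, hf, rfl⟩
    rcases hc.total hf hg with h | h
    · exact (neg_le_neg (h _)).trans ((hsub f hf).neg_map_neg_le x)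
    · exact ((hsub g hg).neg_map_neg_le x).trans (h x)
  have hadd : ∀ x y, ∀ a ∈ S x, ∀ b ∈ S y, ∃ d ∈ S (x + y), d ≤ a + b := by
    rintro x y _ ⟨f, hf, rfl⟩ _ ⟨f', hf', rfl⟩
    rcases hc.total hf hf' with h | h
    · exact ⟨_, ⟨f, hf, rfl⟩, ((hsub f hf).add_le x y).trans (by gcongr; exact h y)⟩
    · exact ⟨_, ⟨f', hf', rfl⟩, ((hsub f' hf').add_le x y).trans (by gcongr; exact h x)⟩
  have hsmul : ∀ t, StrictPos t → ∀ x, ∀ a ∈ S x, ∃ d ∈ S (t • x), d ≤ t * a := by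
    rintro t ht x _ ⟨f, hf, rfl⟩
    exact ⟨_, ⟨f, hf, rfl⟩, (hsub f hf).smul_le t ht x⟩
  obtain ⟨q, hq, hglb⟩ := exists_sublinear_isGLB (S := S) (fun x => ⟨_, g, hg, rfl⟩) hbdd hadd hsmul
  exact ⟨q, hq, fun f hf x => (hglb x).1 ⟨f, hf, rfl⟩⟩

theorem exists_minimal_le [SFinite P] (hq : L0Sublinear q) :
    ∃ f : M → L0 P, f ≤ q ∧ Minimal L0Sublinear f := by
  obtain ⟨f, hqf, hf⟩ := zorn_le_nonempty₀ (α := (M → L0 P)ᵒᵈ)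
    {f | L0Sublinear (OrderDual.ofDual f)}
    (fun c hsub hc f hf => exists_le_of_isChain hc.symm hsub ⟨f, hf⟩) (OrderDual.toDual q) hq
  exact ⟨f, hqf, hf⟩

theorem map_neg_of_minimal [SFinite P] (hq : Minimal L0Sublinear q) (x : M) :
    q (-x) = -q x := by
  obtain ⟨q', hq', hle, hneg⟩ := hq.prop.exists_le_map_neg_le x
  refine le_antisymm ((hq.le_of_le hq' hle _).trans hneg) ?_
  simpa using hq.prop.neg_map_neg_le (-x)

theorem exists_linearMap_of_minimal [SFinite P] (hq : Minimal L0Sublinear q) :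
    ∃ f : M →ₗ[L0 P] L0 P, ∀ x, f x = q x := by
  have hadd : ∀ x y, q (x + y) = q x + q y := fun x y => by
    refine le_antisymm (hq.prop.add_le x y) ?_
    have h := hq.prop.add_le (-x) (-y)
    rw [← neg_add] at h
    simp only [map_neg_of_minimal hq] at h
    rwa [← neg_add, neg_le_neg_iff] at h
  have hsmul : ∀ (t : L0 P) x, q (t • x) = t * q x := fun t x => by
    have hpos : StrictPos (1 + |t|) := strictPos_one.add_nonneg (abs_nonneg t)
    have hpos' : StrictPos (1 + (t + |t|)) :=
      strictPos_one.add_nonneg (neg_le_iff_add_nonneg'.1 (neg_le_abs t))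
    have h := hadd (t • x) ((1 + |t|) • x)
    rw [← add_smul, show t + (1 + |t|) = 1 + (t + |t|) by ring, hq.prop.map_smul hpos,
      hq.prop.map_smul hpos'] at h
    linear_combination -h
  exact ⟨{ toFun := q, map_add' := hadd, map_smul' := hsmul }, fun _ => rfl⟩

theorem exists_linearMap_le [SFinite P] (hq : L0Sublinear q) (z : M) :
    ∃ f : M →ₗ[L0 P] L0 P, (∀ x, f x ≤ q x) ∧ f z = q z := by
  obtain ⟨q', hq', hq'q, hz⟩ := hq.exists_le_map_neg_le z
  obtain ⟨g, hgq', hg⟩ := hq'.exists_minimal_le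
  obtain ⟨f, hf⟩ := exists_linearMap_of_minimal hg
  have hle : ∀ x, f x ≤ q' x := fun x => (hf x).trans_le (hgq' x)
  refine ⟨f, fun x => (hle x).trans (hq'q x), le_antisymm ((hle z).trans (hq'q z)) ?_⟩
  simpa using (hle (-z)).trans hz

end L0Sublinear

end

theorem exists_eventPartition_inter_iUnion_subset {A : ℕ → Set Ω} (hA : ∀ n, MeasurableSet (A n)) :
    ∃ Q : EventPartition Ω, ∀ n, Q.set n ∩ ⋃ k, A k ⊆ A n := by
  let B : ℕ → Set Ω := fun n => A n ∪ (⋃ k, A k)ᶜ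
  have hB : ∀ n, MeasurableSet (B n) := fun n => (hA n).union (MeasurableSet.iUnion hA).compl
  have hcover : ⋃ n, disjointed B n = Set.univ := by
    rw [iUnion_disjointed, ← Set.iUnion_union, Set.union_compl_self]
  exact ⟨⟨disjointed B, fun n => .disjointed hB n, disjoint_disjointed B, hcover⟩,
    fun n ω hω => (disjointed_subset B n hω.1).resolve_right (not_not_intro hω.2)⟩

theorem EventPartition.exists_mem (A : EventPartition Ω) (ω : Ω) : ∃ i, ω ∈ A.set i :=
  Set.mem_iUnion.1 (A.cover ▸ Set.mem_univ ω)

section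

variable {M N ι : Type*} [AddCommGroup M] [Module (L0 P) M] [AddCommGroup N] [Module (L0 P) N]
  {A : EventPartition Ω}

namespace IsConcat

variable {X X' : ℕ → M} {Y Y' : M}

theorem add (h : IsConcat P A X Y) (h' : IsConcat P A X' Y') :
    IsConcat P A (fun i => X i + X' i) (Y + Y') := fun i => by
  rw [smul_add, smul_add, h i, h' i]

theorem sub (h : IsConcat P A X Y) (h' : IsConcat P A X' Y') :
    IsConcat P A (fun i => X i - X' i) (Y - Y') := fun i => by
  rw [smul_sub, smul_sub, h i, h' i]

theorem smul (h : IsConcat P A X Y) (t : L0 P) : IsConcat P A (fun i => t • X i) (t • Y) :=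
  fun i => by rw [smul_comm, h i, smul_comm]

theorem map (h : IsConcat P A X Y) (f : M →ₗ[L0 P] N) : IsConcat P A (fun i => f (X i)) (f Y) :=
  fun i => by rw [← map_smul, ← map_smul, h i]

end IsConcat

theorem isConcat_L0_iff {a : ℕ → L0 P} {b : L0 P} :
    IsConcat P A a b ↔ ∀ i, ∀ᵐ ω ∂P, ω ∈ A.set i → b ω = a i ω :=
  forall_congr' fun i => ind_mul_eq_ind_mul_iff (A.measurable i)

theorem IsConcat.ae_exists_eq {a : ℕ → L0 P} {b : L0 P} (h : IsConcat P A a b) :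
    ∀ᵐ ω ∂P, ∃ i, b ω = a i ω := by
  filter_upwards [ae_all_iff.2 (isConcat_L0_iff.1 h)] with ω h
  obtain ⟨i, hi⟩ := A.exists_mem ω
  exact ⟨i, h i hi⟩

theorem sigmaStable_ball0 (ε : L0 P) : SigmaStable P (ball0 ε) := fun A a ha b hb => by
  rw [mem_ball0]
  filter_upwards [hb.ae_exists_eq, ae_all_iff.2 fun i => mem_ball0.1 (ha i)] with ω ⟨i, hi⟩ h
  rw [hi]
  exact h i

theorem sigmaStable_Ici_zero : SigmaStable P (Set.Ici (0 : L0 P)) := fun A a ha b hb => by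
  rw [Set.mem_Ici, zero_le_iff_ae]
  filter_upwards [hb.ae_exists_eq, ae_all_iff.2 fun i => zero_le_iff_ae.1 (ha i)] with ω ⟨i, hi⟩ h
  rw [hi]
  exact h i

theorem SigmaStable.pi {S : ι → Set M} (hS : ∀ j, SigmaStable P (S j)) :
    SigmaStable P (Set.univ.pi S) := fun A X hX Y hY j _ =>
  hS j A (fun i => X i j) (fun i => hX i j trivial) (Y j) (hY.map (LinearMap.proj j))

variable (P M) in
/-- Every countable concatenation `∑ 1_{A_i} X_i` in `M` exists and is unique. -/
def HasConcat : Prop :=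
  ∀ (A : EventPartition Ω) (X : ℕ → M), ∃! Y, IsConcat P A X Y

theorem HasConcat.ext (hM : HasConcat P M) (A : EventPartition Ω) {Y Z : M}
    (h : ∀ i, ind P (A.set i) (A.measurable i) • Y = ind P (A.set i) (A.measurable i) • Z) :
    Y = Z :=
  (hM A fun _ => Z).unique h fun _ => rfl

theorem HasConcat.pi (hM : HasConcat P M) : HasConcat P (ι → M) := fun A X => by
  choose Y hY using fun j => (hM A fun i => X i j).exists
  exact ⟨Y, fun i => funext fun j => hY j i, fun Z hZ => funext fun j =>
    (hM A _).unique (hZ.map (LinearMap.proj j)) (hY j)⟩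

theorem SigmaStable.sub (hM : HasConcat P M) {C D : Set M} (hC : SigmaStable P C)
    (hD : SigmaStable P D) : SigmaStable P (C - D) := fun A X hX Y hY => by
  choose c hc d hd hX using hX
  obtain ⟨c', hc', -⟩ := hM A c
  obtain ⟨d', hd', -⟩ := hM A d
  obtain rfl : c' - d' = Y := by
    refine (hM A X).unique ?_ hY
    rw [← funext hX]
    exact hc'.sub hd'
  exact Set.sub_mem_sub (hC A c hc c' hc') (hD A d hd d' hd')

end

theorem hasConcat_L0 : HasConcat P (L0 P) := fun A a => by
  obtain ⟨g, hg, hga⟩ := exists_measurable_piecewise A.set A.measurable (fun i => (a i : Ω → ℝ))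
    (fun i => (a i).measurable)
    fun i j hij ω hω => absurd hω.2 (Set.disjoint_left.1 (A.disjoint hij) hω.1)
  obtain ⟨b, hb⟩ := exists_ae_eq_of_measurable (P := P) hg
  refine ⟨b, isConcat_L0_iff.2 fun i => ?_, fun c hc => AEEqFun.ext ?_⟩
  · filter_upwards [hb] with ω h hω
    rw [h, hga i hω]
  · filter_upwards [hb, ae_all_iff.2 (isConcat_L0_iff.1 hc)] with ω h hc
    obtain ⟨i, hi⟩ := A.exists_mem ω
    rw [h, hc i hi, hga i hi]

section

variable {E : Type*} [AddCommGroup E] [Module (L0 P) E] [TopologicalSpace E]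

theorem IsConcat.weakDual_apply {A : EventPartition Ω} {f : ℕ → WeakDual (L0 P) E}
    {g : WeakDual (L0 P) E} (h : IsConcat P A f g) (x : E) :
    IsConcat P A (fun i => f i x) (g x) :=
  fun i => congrArg (fun F : WeakDual (L0 P) E => F x) (h i)

theorem sigmaStable_polarCone (K : Set E) : SigmaStable P (polarCone P K) :=
  fun A f hf _ hg x hx =>
    sigmaStable_Ici_zero A (fun i => f i x) (fun i => hf i x hx) _ (hg.weakDual_apply x)

variable [IsTopologicalAddGroup E] [ContinuousSMul (L0 P) E]

theorem exists_weakDual_of_abs_le_one (f : E →ₗ[L0 P] L0 P) {U : Set E} (hU : U ∈ 𝓝 (0 : E))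
    (hf : ∀ u ∈ U, |f u| ≤ 1) : ∃ F : WeakDual (L0 P) E, ∀ x, F x = f x := by
  suffices hc : Continuous f from ⟨StrongDual.toWeakDual ⟨f, hc⟩, fun _ => rfl⟩
  refine continuous_of_continuousAt_zero f ?_
  rw [ContinuousAt, map_zero, nhds_zero_hasBasis_L0.tendsto_right_iff]
  intro ε hε
  obtain ⟨b, -, hbε⟩ := hε.exists_mul_eq_one
  have hbU : (fun x : E => b • x) ⁻¹' U ∈ 𝓝 (0 : E) :=
    (continuous_const_smul b).continuousAt.preimage_mem_nhds (by rwa [smul_zero])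
  filter_upwards [hbU] with x hx
  calc |f x| = |ε * f (b • x)| := by
        rw [map_smul, smul_eq_mul, ← mul_assoc, mul_comm ε b, hbε, one_mul]
    _ = ε * |f (b • x)| := by rw [abs_mul_L0, abs_of_nonneg hε.nonneg]
    _ ≤ ε * 1 := mul_le_mul_of_nonneg_left (hf _ hx) hε.nonneg
    _ = ε := mul_one ε

theorem CondLocallyConvex.hasConcat_weakDual (hE : CondLocallyConvex P E) :
    HasConcat P (WeakDual (L0 P) E) := fun A f => by
  choose F hF using fun x => (hasConcat_L0 (P := P) A fun i => f i x).exists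
  let L : E →ₗ[L0 P] L0 P :=
    { toFun := F
      map_add' := fun x y => (hasConcat_L0 A _).unique (hF (x + y)) <| by
        simpa only [map_add] using (hF x).add (hF y)
      map_smul' := fun t x => (hasConcat_L0 A _).unique (hF (t • x)) <| by
        simpa only [map_smul, RingHom.id_apply] using (hF x).smul t }
  have hU : ∀ i, (f i) ⁻¹' ball0 1 ∈ 𝓝 (0 : E) := fun i => by
    refine (map_continuous (f i)).continuousAt.preimage_mem_nhds ?_
    rw [map_zero]
    exact nhds_zero_hasBasis_L0.mem_of_mem strictPos_one
  have hbound : ∀ Y ∈ concatSets P A fun i => (f i) ⁻¹' ball0 1, |L Y| ≤ 1 := by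
    rintro Y ⟨X, hX, hY⟩
    refine sigmaStable_ball0 1 A (fun i => f i (X i)) hX (L Y) fun i => ?_
    rw [← map_smul (f i), ← hY i, map_smul]
    exact hF Y i
  obtain ⟨G, hG⟩ := exists_weakDual_of_abs_le_one L (hE.concat_nhds A _ hU) hbound
  refine ⟨G, fun i => DFunLike.ext _ _ fun x => ?_, fun G' hG' => DFunLike.ext _ _ fun x => ?_⟩
  · exact (congrArg (ind P (A.set i) (A.measurable i) • ·) (hG x)).trans (hF x i)
  · exact (hasConcat_L0 A _).unique (hG'.weakDual_apply x) (hG x ▸ hF x)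

end

section

variable {M : Type*} [AddCommGroup M] [Module (L0 P) M]

variable (P) in
/-- `X` lies outside `S` everywhere on the event `A`: no localization `1_B X` with `B ⊆ A` of
positive probability lies in `1_B S`. -/
def OutsideOn (A : Set Ω) (S : Set M) (X : M) : Prop :=
  ∀ (B : Set Ω) (hB : MeasurableSet B), B ⊆ A → ∀ Y ∈ S,
    ind P B hB • X = ind P B hB • Y → P B = 0

theorem SigmaStable.exists_ind_iUnion_smul_eq (hM : HasConcat P M) {S : Set M}
    (hS : SigmaStable P S) {X : M} {B : ℕ → Set Ω} (hB : ∀ n, MeasurableSet (B n)) {Y : ℕ → M}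
    (hY : ∀ n, Y n ∈ S) (hXY : ∀ n, ind P (B n) (hB n) • X = ind P (B n) (hB n) • Y n) :
    ∃ Z ∈ S, ind P _ (MeasurableSet.iUnion hB) • X = ind P _ (MeasurableSet.iUnion hB) • Z := by
  obtain ⟨Q, hQ⟩ := exists_eventPartition_inter_iUnion_subset hB
  obtain ⟨Z, hZ, -⟩ := hM Q Y
  refine ⟨Z, hS Q Y hY Z hZ, hM.ext Q fun n => ?_⟩
  have hXY' := ind_smul_eq_of_subset ((Q.measurable n).inter (.iUnion hB)) (hB n) (hQ n) (hXY n)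
  rw [← ind_mul_ind (Q.measurable n) (.iUnion hB), mul_comm, mul_smul, mul_smul, ← hZ n,
    smul_comm, smul_comm _ (ind P (Q.set n) _)] at hXY'
  exact hXY'

theorem exists_event_outsideOn [SFinite P] (hM : HasConcat P M) {S : Set M} (hne : S.Nonempty)
    (hS : SigmaStable P S) {X : M} (hX : X ∉ S) :
    ∃ A, MeasurableSet A ∧ 0 < P A ∧ OutsideOn P A S X := by
  let 𝓑 : Set (Set Ω) :=
    {B | ∃ hB : MeasurableSet B, ∃ Y ∈ S, ind P B hB • X = ind P B hB • Y}
  have hempty : ∅ ∈ 𝓑 := by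
    obtain ⟨Y, hY⟩ := hne
    refine ⟨.empty, Y, hY, ?_⟩
    rw [(ind_eq_zero_iff _).2 measure_empty, zero_smul, zero_smul]
  have hUnion : ∀ B : ℕ → Set Ω, (∀ n, B n ∈ 𝓑) → ⋃ n, B n ∈ 𝓑 := fun B hB => by
    choose hBm Y hY hXY using hB
    exact ⟨.iUnion hBm, hS.exists_ind_iUnion_smul_eq hM hBm hY hXY⟩
  obtain ⟨B, ⟨hB, Y, hY, hXY⟩, hmax⟩ :=
    exists_ae_greatest_of_iUnion_mem (P := P) ⟨∅, hempty⟩ (fun B hB => hB.1) hUnion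
  refine ⟨Bᶜ, hB.compl, pos_iff_ne_zero.2 fun hPB => hX ?_, fun B' hB' hsub Y' hY' h => ?_⟩
  · have hB1 : ind P B hB = 1 := by
      rw [eq_comm, ← sub_eq_zero, ← ind_compl, ind_eq_zero_iff, hPB]
    rw [hB1, one_smul, one_smul] at hXY
    rwa [hXY]
  · rw [measure_eq_zero_iff_ae_notMem]
    filter_upwards [hmax B' ⟨hB', Y', hY', h⟩] with ω hω hωB'
    exact hsub hωB' (hω hωB')

theorem L0Convex.smul_mem {V : Set M} (hV : L0Convex P V) (h0 : (0 : M) ∈ V) {t : L0 P}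
    (ht : 0 ≤ t) (ht1 : t ≤ 1) {v : M} (hv : v ∈ V) : t • v ∈ V := by
  simpa using hV t ht ht1 v hv 0 h0

theorem L0Convex.sub {C D : Set M} (hC : L0Convex P C) (hD : L0Convex P D) :
    L0Convex P (C - D) := by
  rintro t ht ht1 _ ⟨c, hc, d, hd, rfl⟩ _ ⟨c', hc', d', hd', rfl⟩
  refine ⟨_, hC t ht ht1 c hc c' hc', _, hD t ht ht1 d hd d' hd', ?_⟩
  module

theorem l0Convex_singleton (x : M) : L0Convex P {x} := by
  rintro t - - _ rfl _ rfl
  rw [← add_smul, add_sub_cancel, one_smul, Set.mem_singleton_iff]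

theorem OutsideOn.singleton_sub {A : Set Ω} {S : Set M} {X : M} (hX : OutsideOn P A S X) (c : M) :
    OutsideOn P A ({c} - S) (c - X) := by
  rintro B hB hBA _ ⟨_, rfl, Y, hY, rfl⟩ h
  rw [smul_sub, smul_sub, sub_right_inj] at h
  exact hX B hB hBA Y hY h

theorem OutsideOn.ind_le {A : Set Ω} (hA : MeasurableSet A) {V : Set M} {z : M}
    (hz : OutsideOn P A V z) (hV : L0Convex P V) (h0 : (0 : M) ∈ V) {l : L0 P}
    (hl : StrictPos l) {v : M} (hv : v ∈ V) (hzl : z = l • v) : ind P A hA ≤ l := by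
  have hB : MeasurableSet (A ∩ {ω | l ω < 1}) :=
    hA.inter (measurableSet_lt l.measurable measurable_const)
  have hle : ind P _ hB * l ≤ 1 := by
    rw [le_iff_ae]
    filter_upwards [ae_ind (P := P) _ hB, ae_mul (ind P _ hB) l, ae_one (P := P)]
      with ω h1 h2 h3
    rw [h2, h3, h1]
    by_cases hω : ω ∈ A ∩ {ω | l ω < 1}
    · rw [Set.indicator_of_mem hω, one_mul]
      exact le_of_lt hω.2
    · rw [Set.indicator_of_notMem hω, zero_mul]
      exact zero_le_one
  have hPB : P (A ∩ {ω | l ω < 1}) = 0 := by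
    refine hz _ hB Set.inter_subset_left _
      (hV.smul_mem h0 (mul_nonneg (ind_nonneg _ hB) hl.nonneg) hle hv) ?_
    rw [hzl, mul_smul, ind_smul_ind_smul]
  rw [le_iff_ae]
  filter_upwards [measure_eq_zero_iff_ae_notMem.1 hPB, ae_ind (P := P) A hA, hl] with ω h1 h2 h3
  rw [h2]
  by_cases hω : ω ∈ A
  · rw [Set.indicator_of_mem hω]
    exact not_lt.1 fun hlt => h1 ⟨hω, hlt⟩
  · rw [Set.indicator_of_notMem hω]
    exact h3.le

theorem exists_sublinear_isGLB_gauge [SFinite P] {V : Set M} (hV : L0Convex P V)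
    (hVa : L0Absorbent P V) :
    ∃ q : M → L0 P, L0Sublinear q ∧
      ∀ x, IsGLB {l | StrictPos l ∧ ∃ v ∈ V, x = l • v} (q x) := by
  refine exists_sublinear_isGLB hVa (fun x => ⟨0, fun l hl => hl.1.nonneg⟩) ?_ ?_
  · rintro _ _ l ⟨hl, v, hv, rfl⟩ m ⟨hm, w, hw, rfl⟩
    have hlm : StrictPos (l + m) := hl.add_nonneg hm.nonneg
    obtain ⟨b, hb, hbs⟩ := hlm.exists_mul_eq_one
    have hsub : 1 - b * l = b * m := by rw [← hbs]; ring
    have hle : b * l ≤ 1 := by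
      rw [← sub_nonneg, hsub]
      exact mul_nonneg hb.nonneg hm.nonneg
    refine ⟨l + m,
      ⟨hlm, _, hV (b * l) (mul_nonneg hb.nonneg hl.nonneg) hle v hv w hw, ?_⟩, le_rfl⟩
    rw [hsub, smul_add, smul_smul, smul_smul, ← mul_assoc, ← mul_assoc, mul_comm (l + m), hbs,
      one_mul, one_mul]
  · rintro t ht _ l ⟨hl, v, hv, rfl⟩
    exact ⟨t * l, ⟨ht.mul hl, v, hv, smul_smul t l v⟩, le_rfl⟩

theorem OutsideOn.exists_linearMap [SFinite P] {A : Set Ω} (hA : MeasurableSet A) {V : Set M}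
    {z : M} (hz : OutsideOn P A V z) (hV : L0Convex P V) (hVa : L0Absorbent P V)
    (h0 : (0 : M) ∈ V) :
    ∃ f : M →ₗ[L0 P] L0 P, (∀ v ∈ V, f v ≤ ind P A hA) ∧ ind P A hA ≤ f z := by
  obtain ⟨q, hq, hglb⟩ := exists_sublinear_isGLB_gauge hV hVa
  obtain ⟨f, hfq, hfz⟩ := hq.exists_linearMap_le z
  have hV1 : ∀ v ∈ V, f v ≤ 1 := fun v hv =>
    (hfq v).trans ((hglb v).1 ⟨strictPos_one, v, hv, (one_smul _ v).symm⟩)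
  have hz1 : ind P A hA ≤ f z := by
    rw [hfz]
    refine (hglb z).2 ?_
    rintro l ⟨hl, v, hv, hzl⟩
    exact hz.ind_le hA hV h0 hl hv hzl
  refine ⟨ind P A hA • f, fun v hv => ?_, ?_⟩
  · simpa using mul_le_mul_of_nonneg_left (hV1 v hv) (ind_nonneg A hA)
  · simpa [ind_mul_self] using mul_le_mul_of_nonneg_left hz1 (ind_nonneg A hA)

theorem L0Absorbent.zero_mem {U : Set M} (hU : L0Absorbent P U) (hUb : L0Balanced P U) :
    (0 : M) ∈ U := by
  obtain ⟨-, -, u, hu, -⟩ := hU 0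
  simpa using hUb 0 (by simp) u hu

theorem exists_linear_separation [SFinite P] (hM : HasConcat P M) {C U : Set M}
    (hC : L0Convex P C) (hCne : C.Nonempty) (hCs : SigmaStable P C) (hU : L0Convex P U)
    (hUa : L0Absorbent P U) (hUb : L0Balanced P U) (hUs : SigmaStable P U) {X : M}
    (hX : X ∉ C - U) :
    ∃ (f : M →ₗ[L0 P] L0 P) (e : L0 P), (∀ u ∈ U, |f u| ≤ 1) ∧ 0 ≤ e ∧ e ≠ 0 ∧
      ∀ c ∈ C, f X + e ≤ f c := by
  have hU0 : (0 : M) ∈ U := hUa.zero_mem hUb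
  obtain ⟨A, hA, hPA, hout⟩ :=
    exists_event_outsideOn hM (hCne.sub ⟨0, hU0⟩) (hCs.sub hM hUs) hX
  obtain ⟨c₀, hc₀⟩ := hCne
  let V : Set M := {c₀} - (C - U)
  have hV : L0Convex P V := (l0Convex_singleton c₀).sub (hC.sub hU)
  have hUV : U ⊆ V := fun u hu =>
    ⟨c₀, rfl, c₀ - u, Set.sub_mem_sub hc₀ hu, sub_sub_cancel c₀ u⟩
  have hVa : L0Absorbent P V := fun x => by
    obtain ⟨l, hl, u, hu, h⟩ := hUa x
    exact ⟨l, hl, u, hUV hu, h⟩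
  obtain ⟨f, hfV, hfz⟩ := (hout.singleton_sub c₀).exists_linearMap hA hV hVa (hUV hU0)
  obtain ⟨l, hl, u, hu, hzu⟩ := hUa (c₀ - X)
  obtain ⟨b, hb, hbl⟩ := hl.exists_mul_eq_one
  have hfu : b * ind P A hA ≤ f u := by
    calc b * ind P A hA ≤ b * f (c₀ - X) := mul_le_mul_of_nonneg_left hfz hb.nonneg
      _ = f u := by rw [hzu, map_smul, smul_eq_mul, ← mul_assoc, hbl, one_mul]
  refine ⟨f, f u, fun v hv => ?_, (mul_nonneg hb.nonneg (ind_nonneg A hA)).trans hfu, ?_,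
    fun c hc => ?_⟩
  · have hneg : -v ∈ U := by
      simpa using hUb (-1) (by rw [abs_neg, abs_of_nonneg zero_le_one]) v hv
    have hle := (hfV (-v) (hUV hneg)).trans (ind_le_one A hA)
    rw [map_neg] at hle
    exact abs_le'.2 ⟨(hfV v (hUV hv)).trans (ind_le_one A hA), hle⟩
  · intro h0
    rw [hzu, map_smul, h0, smul_zero] at hfz
    exact hPA.ne' ((ind_eq_zero_iff hA).1 (hfz.antisymm (ind_nonneg A hA)))
  · have h := (hfV _ (Set.sub_mem_sub rfl (Set.sub_mem_sub hc hu))).trans hfz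
    rw [map_sub, map_sub, map_sub, sub_le_sub_iff_left, le_sub_iff_add_le] at h
    exact h

theorem exists_weakDual_separation [SFinite P] {E : Type*} [AddCommGroup E] [Module (L0 P) E]
    [TopologicalSpace E] [IsTopologicalAddGroup E] [ContinuousSMul (L0 P) E]
    (hE : CondLocallyConvex P E) {C : Set E} (hC : IsClosed C) (hCc : L0Convex P C)
    (hCne : C.Nonempty) (hCs : SigmaStable P C) {X : E} (hX : X ∉ C) :
    ∃ (f : WeakDual (L0 P) E) (e : L0 P), 0 ≤ e ∧ e ≠ 0 ∧ ∀ c ∈ C, f X + e ≤ f c := by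
  have hN : {y : E | X + y ∉ C} ∈ 𝓝 (0 : E) :=
    (continuous_const_add X).continuousAt.preimage_mem_nhds
      (hC.isOpen_compl.mem_nhds (by simpa using hX))
  obtain ⟨U, hU, hUN, hUc, hUa, hUb, hUs⟩ := hE.exists_nhds _ hN
  have hXU : X ∉ C - U := by
    rintro ⟨c, hc, u, hu, rfl⟩
    exact hUN hu (by rwa [sub_add_cancel])
  obtain ⟨f, e, hf, he, he0, hsep⟩ :=
    exists_linear_separation hE.existsUnique_concat hCc hCne hCs hUc hUa hUb hUs hXU
  obtain ⟨F, hF⟩ := exists_weakDual_of_abs_le_one f hU hf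
  refine ⟨F, e, he, he0, fun c hc => ?_⟩
  rw [hF, hF]
  exact hsep c hc

end

theorem add_nsmul_mem {M : Type*} [AddMonoid M] {K C : Set M}
    (hCK : ∀ X ∈ C, ∀ Y ∈ K, X + Y ∈ C) {X Y : M} (hX : X ∈ C) (hY : Y ∈ K) (n : ℕ) :
    X + n • Y ∈ C := by
  induction n with
  | zero => rwa [zero_nsmul, add_zero]
  | succ n ih =>
    rw [succ_nsmul, ← add_assoc]
    exact hCK _ ih _ hY

section

variable {E : Type*} [AddCommGroup E] [Module (L0 P) E] [TopologicalSpace E] {K C : Set E}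

theorem ae_smul_weakDual (l : L0 P) (f : WeakDual (L0 P) E) (x : E) :
    ∀ᵐ ω ∂P, (l • f) x ω = l ω * f x ω :=
  ae_mul l (f x)

theorem ae_eval_eq_of_ind_smul_eq {A : Set Ω} (hA : MeasurableSet A) {f g : WeakDual (L0 P) E}
    (h : ind P A hA • f = ind P A hA • g) (x : E) : ∀ᵐ ω ∂P, ω ∈ A → f x ω = g x ω :=
  (ind_mul_eq_ind_mul_iff hA).1 (congrArg (fun F : WeakDual (L0 P) E => F x) h)

theorem ae_map_eq_of_ind_smul_eq {A : Set Ω} (hA : MeasurableSet A) (f : WeakDual (L0 P) E)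
    {x y : E} (h : ind P A hA • x = ind P A hA • y) : ∀ᵐ ω ∂P, ω ∈ A → f x ω = f y ω := by
  rw [← ind_mul_eq_ind_mul_iff hA, ← smul_eq_mul, ← map_smul, h, map_smul, smul_eq_mul]

theorem zero_mem_polarCone (K : Set E) : (0 : WeakDual (L0 P) E) ∈ polarCone P K :=
  fun _ _ => le_rfl

theorem add_mem_polarCone {f g : WeakDual (L0 P) E} (hf : f ∈ polarCone P K)
    (hg : g ∈ polarCone P K) : f + g ∈ polarCone P K :=
  fun X hX => add_nonneg (hf X hX) (hg X hX)

theorem smul_mem_polarCone {l : L0 P} (hl : 0 ≤ l) {f : WeakDual (L0 P) E}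
    (hf : f ∈ polarCone P K) : l • f ∈ polarCone P K :=
  fun X hX => mul_nonneg hl (hf X hX)

theorem concat_mem_polarCone {A : Set Ω} (hA : MeasurableSet A) {f g : WeakDual (L0 P) E}
    (hf : f ∈ polarCone P K) (hg : g ∈ polarCone P K) :
    ind P A hA • f + ind P Aᶜ hA.compl • g ∈ polarCone P K :=
  add_mem_polarCone (smul_mem_polarCone (ind_nonneg _ hA) hf)
    (smul_mem_polarCone (ind_nonneg _ hA.compl) hg)

theorem mem_polarCone_of_forall_le (hCK : ∀ X ∈ C, ∀ Y ∈ K, X + Y ∈ C) (hC : C.Nonempty)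
    {f : WeakDual (L0 P) E} {a : L0 P} (hf : ∀ c ∈ C, a ≤ f c) : f ∈ polarCone P K := by
  obtain ⟨c, hc⟩ := hC
  refine fun k hk => nonneg_of_forall_le_nsmul (a := a - f c) fun n => ?_
  rw [sub_le_iff_le_add', ← map_nsmul, ← map_add]
  exact hf _ (add_nsmul_mem hCK hc hk n)

/-- `p` is the support function `f ↦ ess inf_{X ∈ C} ⟨f, X⟩` of `C`. -/
def IsSupport (C : Set E) (p : WeakDual (L0 P) E → ExtL0 P) : Prop :=
  ∀ f, IsGLB ((fun X => toExt (f X)) '' C) (p f)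

theorem exists_isSupport [SFinite P] (C : Set E) :
    ∃ p : WeakDual (L0 P) E → ExtL0 P, IsSupport C p :=
  Classical.axiomOfChoice fun _ => exists_isGLB_ExtL0 _

namespace IsSupport

variable {p : WeakDual (L0 P) E → ExtL0 P}

theorem le_toExt (hp : IsSupport C p) (f : WeakDual (L0 P) E) {X : E} (hX : X ∈ C) :
    p f ≤ toExt (f X) :=
  (hp f).1 ⟨X, hX, rfl⟩

theorem ae_le (hp : IsSupport C p) (f : WeakDual (L0 P) E) {X : E} (hX : X ∈ C) :
    ∀ᵐ ω ∂P, p f ω ≤ (f X ω : EReal) := by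
  filter_upwards [le_iff_ae.1 (hp.le_toExt f hX), ae_toExt (f X)] with ω h1 h2
  rwa [h2] at h1

theorem le_iff (hp : IsSupport C p) {m : ExtL0 P} {f : WeakDual (L0 P) E} :
    m ≤ p f ↔ ∀ X ∈ C, m ≤ toExt (f X) := by
  rw [le_isGLB_iff (hp f), lowerBounds, Set.mem_ofPred_eq, Set.forall_mem_image]

theorem ae_le_of_forall (hp : IsSupport C p) {g : Ω → EReal} (hg : Measurable g)
    {f : WeakDual (L0 P) E} (h : ∀ X ∈ C, ∀ᵐ ω ∂P, g ω ≤ (f X ω : EReal)) :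
    ∀ᵐ ω ∂P, g ω ≤ p f ω := by
  obtain ⟨m, hm⟩ := exists_ae_eq_of_measurable (P := P) hg
  have hmp : m ≤ p f := hp.le_iff.2 fun X hX => le_iff_ae.2 <| by
    filter_upwards [h X hX, ae_toExt (f X), hm] with ω h1 h2 h3
    rwa [h2, h3]
  filter_upwards [le_iff_ae.1 hmp, hm] with ω h1 h2
  rwa [h2] at h1

theorem ae_le_of_ind_smul_eq (hp : IsSupport C p) {A : Set Ω} (hA : MeasurableSet A)
    {f g : WeakDual (L0 P) E} (h : ind P A hA • f = ind P A hA • g) :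
    ∀ᵐ ω ∂P, ω ∈ A → p f ω ≤ p g ω := by
  classical
  have hle := hp.ae_le_of_forall (f := g)
    (Measurable.piecewise hA (p f).measurable (p g).measurable) fun X hX => by
      filter_upwards [ae_eval_eq_of_ind_smul_eq hA h X, hp.ae_le f hX, hp.ae_le g hX]
        with ω h1 h2 h3
      by_cases hω : ω ∈ A
      · rwa [Set.piecewise_eq_of_mem _ _ _ hω, ← h1 hω]
      · rwa [Set.piecewise_eq_of_notMem _ _ _ hω]
  filter_upwards [hle] with ω h hω
  rwa [Set.piecewise_eq_of_mem _ _ _ hω] at h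

theorem localOn (hp : IsSupport C p) (S : Set (WeakDual (L0 P) E)) : LocalOn S p := by
  intro A hA f _ g _
  have hf := ind_smul_concat (P := P) hA f g
  have hg := ind_compl_smul_concat (P := P) hA f g
  filter_upwards [hp.ae_le_of_ind_smul_eq hA hf, hp.ae_le_of_ind_smul_eq hA hf.symm,
    hp.ae_le_of_ind_smul_eq hA.compl hg, hp.ae_le_of_ind_smul_eq hA.compl hg.symm]
    with ω h1 h2 h3 h4
  exact ⟨fun hω => le_antisymm (h1 hω) (h2 hω), fun hω => le_antisymm (h3 hω) (h4 hω)⟩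

theorem mul_le (hp : IsSupport C p) {l : L0 P} (hl : 0 ≤ l) (f : WeakDual (L0 P) E) :
    ∀ᵐ ω ∂P, (l ω : EReal) * p f ω ≤ p (l • f) ω := by
  refine hp.ae_le_of_forall (l.measurable.coe_real_ereal.mul (p f).measurable) fun X hX => ?_
  filter_upwards [hp.ae_le f hX, zero_le_iff_ae.1 hl, ae_smul_weakDual l f X] with ω h1 h2 h3
  rw [h3, EReal.coe_mul]
  exact mul_le_mul_of_nonneg_left h1 (EReal.coe_nonneg.2 h2)

theorem posHomogeneousOn (hp : IsSupport C p) (S : Set (WeakDual (L0 P) E)) :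
    PosHomogeneousOn S p := by
  intro l hl f _
  obtain ⟨b, hb, hbl⟩ := hl.exists_mul_eq_one
  have hle := hp.mul_le hb.nonneg (l • f)
  rw [smul_smul, hbl, one_smul] at hle
  filter_upwards [hle, hp.mul_le hl.nonneg f, hl, ae_mul b l, ae_one (P := P)]
    with ω h1 h2 h3 h4 h5
  rw [hbl, h5] at h4
  refine le_antisymm ?_ h2
  calc p (l • f) ω = (l ω : EReal) * ((b ω : EReal) * p (l • f) ω) := by
        rw [← mul_assoc, ← EReal.coe_mul, mul_comm (l ω), ← h4, EReal.coe_one, one_mul]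
    _ ≤ (l ω : EReal) * p f ω := mul_le_mul_of_nonneg_left h1 (EReal.coe_nonneg.2 h3.le)

theorem l0ConcaveOn (hp : IsSupport C p) (S : Set (WeakDual (L0 P) E)) : L0ConcaveOn S p := by
  intro l hl hl1 f _ g _
  refine hp.ae_le_of_forall ((l.measurable.coe_real_ereal.mul (p f).measurable).add
    ((measurable_const.sub l.measurable).coe_real_ereal.mul (p g).measurable)) fun X hX => ?_
  filter_upwards [hp.ae_le f hX, hp.ae_le g hX, zero_le_iff_ae.1 hl, le_iff_ae.1 hl1,
    ae_one (P := P), ae_sub 1 l, ae_smul_weakDual l f X, ae_smul_weakDual (1 - l) g X,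
    ae_add ((l • f) X) (((1 - l) • g) X)] with ω h1 h2 h3 h4 h5 h6 h7 h8 h9
  rw [h5] at h4 h6
  have hval : (l • f + (1 - l) • g) X ω = l ω * f X ω + (1 - l ω) * g X ω := by
    rw [← h6, ← h7, ← h8, ← h9]
    rfl
  rw [hval, EReal.coe_add, EReal.coe_mul, EReal.coe_mul]
  exact add_le_add (mul_le_mul_of_nonneg_left h1 (EReal.coe_nonneg.2 h3))
    (mul_le_mul_of_nonneg_left h2 (EReal.coe_nonneg.2 (sub_nonneg.2 h4)))

theorem ae_eq_top (hp : IsSupport (∅ : Set E) p) (f : WeakDual (L0 P) E) :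
    ∀ᵐ ω ∂P, p f ω = ⊤ :=
  (hp.ae_le_of_forall (f := f) (g := fun _ => ⊤) measurable_const (by simp)).mono
    fun _ => top_le_iff.1

theorem maximalInvariantOn (hp : IsSupport C p) (S : Set (WeakDual (L0 P) E)) :
    MaximalInvariantOn S p := by
  rintro ⟨f, -, hf⟩ g -
  rcases C.eq_empty_or_nonempty with rfl | ⟨X, hX⟩
  · exact hp.ae_eq_top g
  · filter_upwards [hf, hp.ae_le f hX] with ω htop hle
    rw [htop, top_le_iff] at hle
    exact absurd hle (EReal.coe_ne_top _)

theorem upperSemicontOn (hp : IsSupport C p) (S : Set (WeakDual (L0 P) E)) :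
    UpperSemicontOn S p := by
  intro m
  simp only [hp.le_iff, Set.ofPred_forall]
  exact isClosed_biInter fun X _ =>
    (isClosed_le_toExt m).preimage ((WeakDual.eval_continuous X).comp continuous_subtype_val)

theorem isPenaltyOn (hp : IsSupport C p) (S : Set (WeakDual (L0 P) E)) :
    IsPenaltyOn S p :=
  ⟨hp.localOn S, hp.posHomogeneousOn S, hp.l0ConcaveOn S, hp.maximalInvariantOn S,
    hp.upperSemicontOn S⟩

theorem map_zero (hp : IsSupport C p) (hC : C.Nonempty) : p 0 = toExt 0 := by
  have h : (fun X => toExt ((0 : WeakDual (L0 P) E) X)) '' C = {toExt 0} := by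
    rw [← hC.image_const]
    rfl
  exact (hp 0).unique (h ▸ isGLB_singleton)

theorem represents [IsTopologicalAddGroup E] [ContinuousSMul (L0 P) E] [SFinite P] [NeZero P]
    (hE : CondLocallyConvex P E) (hC : IsClosed C) (hCc : L0Convex P C)
    (hCK : ∀ X ∈ C, ∀ Y ∈ K, X + Y ∈ C) (hCs : SigmaStable P C) (hp : IsSupport C p) :
    Represents (polarCone P K) p C := by
  refine fun X => ⟨fun hX f _ => hp.le_toExt f hX, fun h => ?_⟩
  by_contra hX
  obtain ⟨f, hf, e, he, he0, hsep⟩ : ∃ f ∈ polarCone P K, ∃ e : L0 P, 0 ≤ e ∧ e ≠ 0 ∧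
      ∀ c ∈ C, f X + e ≤ f c := by
    rcases C.eq_empty_or_nonempty with rfl | hne
    · refine ⟨0, zero_mem_polarCone K, 1, zero_le_one, fun h10 => ?_, by simp⟩
      obtain ⟨ω, h1, h0⟩ := ((ae_one (P := P)).and ae_zero).exists
      rw [h10, h0] at h1
      exact zero_ne_one h1
    · obtain ⟨f, e, he, he0, hsep⟩ := exists_weakDual_separation hE hC hCc hne hCs hX
      exact ⟨f, mem_polarCone_of_forall_le hCK hne hsep, e, he, he0, hsep⟩
  have hle : toExt (f X + e) ≤ toExt (f X) :=
    (hp.le_iff.2 fun c hc => toExt_le_toExt.2 (hsep c hc)).trans (h f hf)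
  rw [toExt_le_toExt, add_le_iff_nonpos_right] at hle
  exact he0 (hle.antisymm he)

end IsSupport

end

theorem l0Convex_ball0 (ε : L0 P) : L0Convex P (ball0 ε) := fun l hl hl1 a ha b hb => by
  have hl1 : 0 ≤ 1 - l := sub_nonneg.2 hl1
  calc |l • a + (1 - l) • b| ≤ |l • a| + |(1 - l) • b| := abs_add_le _ _
    _ = l * |a| + (1 - l) * |b| := by
        rw [smul_eq_mul, smul_eq_mul, abs_mul_L0, abs_mul_L0, abs_of_nonneg hl, abs_of_nonneg hl1]
    _ ≤ l * ε + (1 - l) * ε :=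
        add_le_add (mul_le_mul_of_nonneg_left ha hl) (mul_le_mul_of_nonneg_left hb hl1)
    _ = ε := by ring

theorem l0Balanced_ball0 (ε : L0 P) : L0Balanced P (ball0 ε) := fun l hl a ha => by
  calc |l • a| = |l| * |a| := abs_mul_L0 l a
    _ ≤ 1 * |a| := mul_le_mul_of_nonneg_right hl (abs_nonneg a)
    _ ≤ ε := (one_mul |a|).trans_le ha

theorem l0Absorbent_pi_ball0 {ι : Type*} [Finite ι] {ε : ι → L0 P} (hε : ∀ j, StrictPos (ε j)) :
    L0Absorbent P (Set.univ.pi fun j => ball0 (ε j)) := fun u => by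
  have := Fintype.ofFinite ι
  choose b hb hbε using fun j => (hε j).exists_mul_eq_one
  have hterm : ∀ j, 0 ≤ |u j| * b j := fun j => mul_nonneg (abs_nonneg _) (hb j).nonneg
  have hl : StrictPos (1 + ∑ j, |u j| * b j) :=
    strictPos_one.add_nonneg (Finset.sum_nonneg fun j _ => hterm j)
  obtain ⟨c, hc, hcl⟩ := hl.exists_mul_eq_one
  refine ⟨_, hl, c • u, fun j _ => ?_, by rw [smul_smul, mul_comm, hcl, one_smul]⟩
  have hle : |u j| * b j ≤ 1 + ∑ i, |u i| * b i :=
    (Finset.single_le_sum (fun i _ => hterm i) (Finset.mem_univ j)).trans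
      (le_add_of_nonneg_left zero_le_one)
  calc |c * u j| = c * |u j| := by rw [abs_mul_L0, abs_of_nonneg hc.nonneg]
    _ = c * (|u j| * b j) * ε j := by rw [mul_assoc, mul_assoc, hbε, mul_one]
    _ ≤ c * (1 + ∑ i, |u i| * b i) * ε j :=
        mul_le_mul_of_nonneg_right (mul_le_mul_of_nonneg_left hle hc.nonneg) (hε j).nonneg
    _ = ε j := by rw [hcl, one_mul]

section

variable {M N ι : Type*} [AddCommGroup M] [Module (L0 P) M] [AddCommGroup N] [Module (L0 P) N]

theorem L0Convex.pi {S : ι → Set M} (hS : ∀ j, L0Convex P (S j)) :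
    L0Convex P (Set.univ.pi S) :=
  fun l hl hl1 X hX Y hY j hj => hS j l hl hl1 (X j) (hX j hj) (Y j) (hY j hj)

theorem L0Balanced.pi {S : ι → Set M} (hS : ∀ j, L0Balanced P (S j)) :
    L0Balanced P (Set.univ.pi S) :=
  fun l hl X hX j hj => hS j l hl (X j) (hX j hj)

theorem L0Convex.image {S : Set M} (hS : L0Convex P S) (T : M →ₗ[L0 P] N) :
    L0Convex P (T '' S) := by
  rintro l hl hl1 _ ⟨X, hX, rfl⟩ _ ⟨Y, hY, rfl⟩
  exact ⟨_, hS l hl hl1 X hX Y hY, by rw [map_add, map_smul, map_smul]⟩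

theorem HasConcat.prod (hM : HasConcat P M) (hN : HasConcat P N) : HasConcat P (M × N) :=
  fun A X => by
    obtain ⟨Y, hY⟩ := (hM A fun i => (X i).1).exists
    obtain ⟨Z, hZ⟩ := (hN A fun i => (X i).2).exists
    exact ⟨(Y, Z), fun i => Prod.ext (hY i) (hZ i), fun W hW => Prod.ext
      ((hM A _).unique (hW.map (LinearMap.fst _ M N)) hY)
      ((hN A _).unique (hW.map (LinearMap.snd _ M N)) hZ)⟩

theorem SigmaStable.image (hM : HasConcat P M) (hN : HasConcat P N) {S : Set M}
    (hS : SigmaStable P S) (T : M →ₗ[L0 P] N) : SigmaStable P (T '' S) := fun A X hX Y hY => by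
  choose s hs hsX using hX
  obtain ⟨m, hm⟩ := (hM A s).exists
  refine ⟨m, hS A s hs m hm, (hN A X).unique ?_ hY⟩
  rw [← funext hsX]
  exact hm.map T

end

section

variable {E : Type*} [AddCommGroup E] [Module (L0 P) E] [TopologicalSpace E]
  {K : Set E} {S : Set (WeakDual (L0 P) E)} {q : WeakDual (L0 P) E → ExtL0 P}

theorem exists_finset_nhds_weakDual {f : WeakDual (L0 P) E} {W : Set (WeakDual (L0 P) E)}
    (hW : W ∈ 𝓝 f) : ∃ (I : Finset E) (ε : E → L0 P), (∀ x, StrictPos (ε x)) ∧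
      ∀ g : WeakDual (L0 P) E, (∀ x ∈ I, |g x - f x| ≤ ε x) → g ∈ W := by
  have hind : Topology.IsInducing fun (g : WeakDual (L0 P) E) (x : E) => g x := ⟨rfl⟩
  rw [hind.nhds_eq_comap, mem_comap] at hW
  obtain ⟨T, hT, hTW⟩ := hW
  rw [nhds_pi, Filter.mem_pi'] at hT
  obtain ⟨I, t, ht, htT⟩ := hT
  choose ε hε hεt using fun x => (nhds_hasBasis_L0 (f x)).mem_iff.1 (ht x)
  exact ⟨I, ε, hε, fun g hg => hTW (htT fun x hx => hεt x (hg x hx))⟩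

theorem LocalOn.ae_eq_of_ind_smul_eq (hq : LocalOn S q) {A : Set Ω} (hA : MeasurableSet A)
    {f g : WeakDual (L0 P) E} (hf : f ∈ S) (hg : g ∈ S) (h : ind P A hA • f = ind P A hA • g) :
    ∀ᵐ ω ∂P, ω ∈ A → q f ω = q g ω := by
  have hloc := hq A hA g hg f hf
  rw [← h, ind_smul_add_ind_compl_smul hA f] at hloc
  exact hloc.mono fun _ => And.left

/-- The hypograph of `q` over `S`, as a set of pairs of a continuous linear form and a real level;
it carries the convexity and separation arguments for extended-valued functions. -/
def hypograph (S : Set (WeakDual (L0 P) E)) (q : WeakDual (L0 P) E → ExtL0 P) :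
    Set (WeakDual (L0 P) E × L0 P) :=
  {z | z.1 ∈ S ∧ toExt z.2 ≤ q z.1}

theorem ae_le_of_mem_hypograph {z : WeakDual (L0 P) E × L0 P} (hz : z ∈ hypograph S q) :
    ∀ᵐ ω ∂P, (z.2 ω : EReal) ≤ q z.1 ω := by
  filter_upwards [le_iff_ae.1 hz.2, ae_toExt z.2] with ω h1 h2
  rwa [h2] at h1

theorem mem_hypograph_of_ae_le {z : WeakDual (L0 P) E × L0 P} (hz : z.1 ∈ S)
    (h : ∀ᵐ ω ∂P, (z.2 ω : EReal) ≤ q z.1 ω) : z ∈ hypograph S q := by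
  refine ⟨hz, le_iff_ae.2 ?_⟩
  filter_upwards [h, ae_toExt z.2] with ω h1 h2
  rwa [h2]

theorem l0Convex_hypograph (hq : L0ConcaveOn (polarCone P K) q) :
    L0Convex P (hypograph (polarCone P K) q) := by
  intro l hl hl1 y hy z hz
  have hl1' : 0 ≤ 1 - l := sub_nonneg.2 hl1
  refine mem_hypograph_of_ae_le
    (add_mem_polarCone (smul_mem_polarCone hl hy.1) (smul_mem_polarCone hl1' hz.1)) ?_
  filter_upwards [hq l hl hl1 y.1 hy.1 z.1 hz.1, ae_le_of_mem_hypograph hy,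
    ae_le_of_mem_hypograph hz, zero_le_iff_ae.1 hl, zero_le_iff_ae.1 hl1', ae_one (P := P),
    ae_sub 1 l, ae_add (l * y.2) ((1 - l) * z.2), ae_mul l y.2, ae_mul (1 - l) z.2]
    with ω h1 h2 h3 h4 h5 h6 h7 h8 h9 h10
  have hval : (l • y + (1 - l) • z).2 ω = l ω * y.2 ω + (1 - l ω) * z.2 ω := by
    rw [← h6, ← h7, ← h9, ← h10, ← h8]
    rfl
  rw [h7, h6] at h5
  rw [hval, EReal.coe_add, EReal.coe_mul, EReal.coe_mul]
  exact (add_le_add (mul_le_mul_of_nonneg_left h2 (EReal.coe_nonneg.2 h4))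
    (mul_le_mul_of_nonneg_left h3 (EReal.coe_nonneg.2 h5))).trans h1

theorem smul_mem_hypograph (hq : PosHomogeneousOn (polarCone P K) q) {l : L0 P}
    (hl : StrictPos l) {z : WeakDual (L0 P) E × L0 P} (hz : z ∈ hypograph (polarCone P K) q) :
    l • z ∈ hypograph (polarCone P K) q := by
  refine mem_hypograph_of_ae_le (smul_mem_polarCone hl.nonneg hz.1) ?_
  filter_upwards [hq l hl z.1 hz.1, ae_le_of_mem_hypograph hz, hl, ae_mul l z.2]
    with ω h1 h2 h3 h4
  have hval : (l • z).2 ω = l ω * z.2 ω := h4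
  rw [Prod.smul_fst, h1, hval, EReal.coe_mul]
  exact mul_le_mul_of_nonneg_left h2 (EReal.coe_nonneg.2 h3.le)

theorem nsmul_mem_hypograph (hq : PosHomogeneousOn (polarCone P K) q) (hq0 : q 0 = toExt 0)
    (n : ℕ) {z : WeakDual (L0 P) E × L0 P} (hz : z ∈ hypograph (polarCone P K) q) :
    n • z ∈ hypograph (polarCone P K) q := by
  rcases n with _ | n
  · rw [zero_nsmul]
    exact ⟨zero_mem_polarCone K, hq0.ge⟩
  · have hn : StrictPos (((n + 1 : ℕ) : L0 P)) := by
      rw [Nat.cast_succ, add_comm]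
      exact strictPos_one.add_nonneg (Nat.cast_nonneg n)
    rw [← Nat.cast_smul_eq_nsmul (L0 P)]
    exact smul_mem_hypograph hq hn hz

theorem sigmaStable_hypograph (hq : LocalOn (polarCone P K) q) :
    SigmaStable P (hypograph (polarCone P K) q) := by
  intro A z hz y hy
  have hfst : y.1 ∈ polarCone P K := sigmaStable_polarCone K A _ (fun i => (hz i).1) y.1
    (hy.map (LinearMap.fst (L0 P) _ _))
  have hsnd := hy.map (LinearMap.snd (L0 P) _ _)
  refine mem_hypograph_of_ae_le hfst ?_
  filter_upwards [ae_all_iff.2 fun i => ae_le_of_mem_hypograph (hz i),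
    ae_all_iff.2 (isConcat_L0_iff.1 hsnd),
    ae_all_iff.2 fun i => hq.ae_eq_of_ind_smul_eq (A.measurable i) hfst (hz i).1
      (congrArg Prod.fst (hy i))] with ω h1 h2 h3
  obtain ⟨i, hi⟩ := A.exists_mem ω
  have hlevel : y.2 ω = (z i).2 ω := h2 i hi
  rw [hlevel, h3 i hi]
  exact h1 i

end

section

variable {ι E : Type*} [AddCommGroup E] [Module (L0 P) E] [TopologicalSpace E]
  {K : Set E} {q : WeakDual (L0 P) E → ExtL0 P}

/-- Evaluation of a form at the points `x i`, together with a level; the level is the coordinate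
`none`. It maps the hypograph to a finite product of copies of `L⁰`. -/
def evalLevel (x : ι → E) : WeakDual (L0 P) E × L0 P →ₗ[L0 P] (Option ι → L0 P) where
  toFun z j := j.elim z.2 fun i => z.1 (x i)
  map_add' _ _ := by
    funext j
    cases j <;> rfl
  map_smul' _ _ := by
    funext j
    cases j <;> rfl

theorem exists_apply_evalLevel [Finite ι] (x : ι → E) (F : (Option ι → L0 P) →ₗ[L0 P] L0 P) :
    ∃ (X : E) (r : L0 P), ∀ z, F (evalLevel x z) = z.1 X - r * z.2 := by
  classical
  have := Fintype.ofFinite ι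
  refine ⟨∑ i, F (Pi.single (some i) 1) • x i, -F (Pi.single none 1), fun z => ?_⟩
  calc F (evalLevel x z) = F (∑ j, evalLevel x z j • Pi.single j 1) := by
        rw [← pi_eq_sum_univ']
    _ = z.2 * F (Pi.single none 1) + ∑ i, z.1 (x i) * F (Pi.single (some i) 1) := by
        rw [map_sum, Fintype.sum_option]
        simp only [map_smul, smul_eq_mul]
        rfl
    _ = z.1 (∑ i, F (Pi.single (some i) 1) • x i) - -F (Pi.single none 1) * z.2 := by
        simp only [map_sum, map_smul, smul_eq_mul, mul_comm]
        ring

theorem UpperSemicontOn.exists_finset_not_le (hq : UpperSemicontOn (polarCone P K) q)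
    {f₀ : WeakDual (L0 P) E} (hf₀ : f₀ ∈ polarCone P K) {m : ExtL0 P} (hm : ¬ m ≤ q f₀) :
    ∃ (I : Finset E) (ε : E → L0 P), (∀ x, StrictPos (ε x)) ∧
      ∀ f ∈ polarCone P K, (∀ x ∈ I, |f x - f₀ x| ≤ ε x) → ¬ m ≤ q f := by
  have hW : {f : polarCone P K | m ≤ q f}ᶜ ∈ 𝓝 (⟨f₀, hf₀⟩ : polarCone P K) :=
    (hq m).isOpen_compl.mem_nhds hm
  rw [nhds_subtype_eq_comap, mem_comap] at hW
  obtain ⟨W, hW, hWq⟩ := hW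
  obtain ⟨I, ε, hε, hI⟩ := exists_finset_nhds_weakDual hW
  exact ⟨I, ε, hε, fun f hf hfI => @hWq ⟨f, hf⟩ (hI f hfI)⟩

variable [IsTopologicalAddGroup E] [ContinuousSMul (L0 P) E]

theorem exists_hypograph_separation [SFinite P] (hE : CondLocallyConvex P E)
    (hq : IsPenaltyOn (polarCone P K) q) (hq0 : q 0 = toExt 0) {f₀ : WeakDual (L0 P) E}
    (hf₀ : f₀ ∈ polarCone P K) {s : L0 P} (hs : ¬ toExt s ≤ q f₀) :
    ∃ (X : E) (r e : L0 P), 0 ≤ e ∧ e ≠ 0 ∧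
      ∀ z ∈ hypograph (polarCone P K) q, f₀ X - r * s + e ≤ z.1 X - r * z.2 := by
  obtain ⟨δ, hδ, hsδ⟩ : ∃ δ, StrictPos δ ∧ ¬ toExt (s - δ) ≤ q f₀ := by
    by_contra! h
    exact hs (toExt_le_of_forall_sub_le h)
  obtain ⟨I, ε, hε, hI⟩ := hq.upperSemicont.exists_finset_not_le hf₀ hsδ
  let T : WeakDual (L0 P) E × L0 P →ₗ[L0 P] (Option I → L0 P) := evalLevel fun x : I => (x : E)
  let η : Option I → L0 P := fun j => j.elim δ fun x => ε x
  have hη : ∀ j, StrictPos (η j) := Option.rec hδ fun x => hε x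
  have hconcat : HasConcat P (Option I → L0 P) := hasConcat_L0.pi
  have hout : T (f₀, s) ∉ T '' hypograph (polarCone P K) q - Set.univ.pi fun j => ball0 (η j) := by
    rintro ⟨_, ⟨⟨f, t⟩, ⟨hf, ht⟩, rfl⟩, u, hu, heq⟩
    obtain rfl : u = T (f, t) - T (f₀, s) := by
      rw [← heq]
      exact (sub_sub_cancel _ _).symm
    have hst : -(t - s) ≤ δ := (abs_le'.1 (hu none trivial)).2
    rw [neg_sub, sub_le_comm] at hst
    exact hI f hf (fun x hx => hu (some ⟨x, hx⟩) trivial) ((toExt_le_toExt.2 hst).trans ht)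
  have hzero : ((0 : WeakDual (L0 P) E), (0 : L0 P)) ∈ hypograph (polarCone P K) q :=
    ⟨zero_mem_polarCone K, hq0.ge⟩
  have hstable := (sigmaStable_hypograph hq.isLocal).image
    (hE.hasConcat_weakDual.prod hasConcat_L0) hconcat T
  obtain ⟨F, e, -, he, he0, hF⟩ := exists_linear_separation hconcat
    ((l0Convex_hypograph hq.concave).image T)
    ⟨_, Set.mem_image_of_mem T hzero⟩ hstable
    (L0Convex.pi fun j => l0Convex_ball0 (η j)) (l0Absorbent_pi_ball0 hη)
    (L0Balanced.pi fun j => l0Balanced_ball0 (η j))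
    (SigmaStable.pi fun j => sigmaStable_ball0 (η j)) hout
  obtain ⟨X, r, hX⟩ := exists_apply_evalLevel (fun x : I => (x : E)) F
  refine ⟨X, r, e, he, he0, fun z hz => ?_⟩
  rw [← hX z, ← hX (f₀, s)]
  exact hF _ (Set.mem_image_of_mem T hz)

theorem exists_point_separation [SFinite P] (hE : CondLocallyConvex P E)
    (hq : IsPenaltyOn (polarCone P K) q) (hq0 : q 0 = toExt 0) {f₀ : WeakDual (L0 P) E}
    (hf₀ : f₀ ∈ polarCone P K) {s : L0 P} (hs : ¬ toExt s ≤ q f₀) :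
    ∃ (X : E) (r : L0 P), 0 ≤ r ∧ (∀ z ∈ hypograph (polarCone P K) q, r * z.2 ≤ z.1 X) ∧
      ¬ r * s ≤ f₀ X := by
  obtain ⟨X, r, e, he, he0, hsep⟩ := exists_hypograph_separation hE hq hq0 hf₀ hs
  have hle : ∀ z ∈ hypograph (polarCone P K) q, r * z.2 ≤ z.1 X := fun z hz => by
    refine sub_nonneg.1 (nonneg_of_forall_le_nsmul (a := f₀ X - r * s + e) fun n => ?_)
    have hval : n • (z.1 X - r * z.2) = (n • z).1 X - r * (n • z).2 := by
      rw [nsmul_sub, ← mul_smul_comm]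
      rfl
    rw [hval]
    exact hsep _ (nsmul_mem_hypograph hq.posHomogeneous hq0 n hz)
  have hzero : ∀ t : L0 P, t ≤ 0 → ((0 : WeakDual (L0 P) E), t) ∈ hypograph (polarCone P K) q :=
    fun t ht => ⟨zero_mem_polarCone K, (toExt_le_toExt.2 ht).trans hq0.ge⟩
  refine ⟨X, r, ?_, hle, fun hrs => he0 (le_antisymm ?_ he)⟩
  · have h : r * -1 ≤ 0 := hle _ (hzero (-1) (neg_nonpos.2 zero_le_one))
    rwa [mul_neg, mul_one, neg_nonpos] at h
  · have h : f₀ X - r * s + e ≤ 0 - r * 0 := hsep _ (hzero 0 le_rfl)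
    rw [mul_zero, sub_zero] at h
    exact (le_add_of_nonneg_left (sub_nonneg.2 hrs)).trans h

end

section

variable {E : Type*} [AddCommGroup E] [Module (L0 P) E] [TopologicalSpace E]
  {K C : Set E} {S : Set (WeakDual (L0 P) E)} {p q : WeakDual (L0 P) E → ExtL0 P}

theorem Represents.ae_le (hR : Represents S q C) {f : WeakDual (L0 P) E} (hf : f ∈ S) {X : E}
    (hX : X ∈ C) : ∀ᵐ ω ∂P, q f ω ≤ (f X ω : EReal) := by
  filter_upwards [le_iff_ae.1 ((hR X).1 hX f hf), ae_toExt (f X)] with ω h1 h2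
  rwa [h2] at h1

theorem Represents.mem_of_ae_le (hR : Represents S q C) {X : E}
    (h : ∀ f ∈ S, ∀ᵐ ω ∂P, q f ω ≤ (f X ω : EReal)) : X ∈ C := by
  refine (hR X).2 fun f hf => le_iff_ae.2 ?_
  filter_upwards [h f hf, ae_toExt (f X)] with ω h1 h2
  rwa [h2]

theorem Represents.le_support (hR : Represents S q C) (hp : IsSupport C p)
    {f : WeakDual (L0 P) E} (hf : f ∈ S) : q f ≤ p f :=
  hp.le_iff.2 fun X hX => (hR X).1 hX f hf

theorem LocalOn.ae_mul_toReal_le (hq : LocalOn (polarCone P K) q) (hq0 : q 0 = toExt 0) {X : E}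
    {r : L0 P} (hsep : ∀ z ∈ hypograph (polarCone P K) q, r * z.2 ≤ z.1 X)
    {f : WeakDual (L0 P) E} (hf : f ∈ polarCone P K) :
    ∀ᵐ ω ∂P, q f ω ≠ ⊥ → r ω * (q f ω).toReal ≤ f X ω := by
  have hD : MeasurableSet {ω | q f ω ≠ ⊥} := (q f).measurable (measurableSet_singleton ⊥).compl
  have hfD := ind_smul_concat (P := P) hD f 0
  set g : WeakDual (L0 P) E := ind P _ hD • f + ind P _ hD.compl • 0 with hg
  have hgK : g ∈ polarCone P K := concat_mem_polarCone hD hf (zero_mem_polarCone K)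
  have hqg := hq _ hD f hf 0 (zero_mem_polarCone K)
  rw [← hg] at hqg
  obtain ⟨t, ht⟩ := exists_ae_eq_of_measurable (P := P) (q g).measurable.ereal_toReal
  have hmem : (g, t) ∈ hypograph (polarCone P K) q := by
    refine mem_hypograph_of_ae_le hgK ?_
    filter_upwards [hqg, ht, ae_toExt (P := P) 0] with ω h1 h2 h3
    rw [h2]
    refine EReal.coe_toReal_le fun hbot => ?_
    by_cases hω : q f ω ≠ ⊥
    · exact hω ((h1.1 hω).symm.trans hbot)
    · rw [h1.2 hω, hq0, h3] at hbot
      exact EReal.coe_ne_bot _ hbot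
  filter_upwards [le_iff_ae.1 (hsep _ hmem), ae_mul r t, ht, hqg,
    ae_eval_eq_of_ind_smul_eq hD hfD X] with ω h1 h2 h3 h4 h5 hω
  rwa [h2, h3, h4.1 hω, h5 hω] at h1

theorem Represents.smul_add_smul_mem (hR : Represents (polarCone P K) q C)
    (hq : LocalOn (polarCone P K) q) (hq0 : q 0 = toExt 0) {X : E} {r : L0 P}
    (hsep : ∀ z ∈ hypograph (polarCone P K) q, r * z.2 ≤ z.1 X) {a b : L0 P} (ha : 0 ≤ a)
    (hb : 0 ≤ b) (hab : b * (1 + a * r) = 1) {c : E} (hc : c ∈ C) : b • (c + a • X) ∈ C := by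
  refine hR.mem_of_ae_le fun f hf => ?_
  have hval : f (b • (c + a • X)) = b * (f c + a * f X) := by
    simp only [map_smul, map_add, smul_eq_mul]
  rw [hval]
  filter_upwards [hq.ae_mul_toReal_le hq0 hsep hf, hR.ae_le hf hc, zero_le_iff_ae.1 ha,
    zero_le_iff_ae.1 hb, ae_mul b (1 + a * r), ae_add 1 (a * r), ae_mul a r, ae_one (P := P),
    ae_mul b (f c + a * f X), ae_add (f c) (a * f X), ae_mul a (f X)]
    with ω h1 h2 h3 h4 h5 h6 h7 h8 h9 h10 h11
  rw [hab, h6, h7, h8] at h5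
  rw [h9, h10, h11]
  by_cases hbot : q f ω = ⊥
  · rw [hbot]
    exact bot_le
  · have htop : q f ω ≠ ⊤ := ne_top_of_le_ne_top (EReal.coe_ne_top _) h2
    replace h1 := h1 hbot
    lift q f ω to ℝ using ⟨htop, hbot⟩ with x
    rw [EReal.toReal_coe] at h1
    rw [EReal.coe_le_coe_iff] at h2 ⊢
    calc x = b ω * (x + a ω * (r ω * x)) := by linear_combination x * h5
      _ ≤ b ω * (f c ω + a ω * f X ω) := by gcongr

theorem Represents.toExt_le_of_forall_le [IsTopologicalAddGroup E] [ContinuousSMul (L0 P) E]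
    [SFinite P] (hR : Represents (polarCone P K) q C) (hE : CondLocallyConvex P E)
    (hq : IsPenaltyOn (polarCone P K) q) (hq0 : q 0 = toExt 0) (hC : C.Nonempty)
    {f : WeakDual (L0 P) E} (hf : f ∈ polarCone P K) {s : L0 P} (hs : ∀ X ∈ C, s ≤ f X) :
    toExt s ≤ q f := by
  by_contra hsq
  obtain ⟨X, r, hr, hsep, hX⟩ := exists_point_separation hE hq hq0 hf hsq
  obtain ⟨c, hc⟩ := hC
  refine hX (sub_nonneg.1 (nonneg_of_forall_le_nsmul (a := s - f c) fun n => ?_))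
  have hn : (0 : L0 P) ≤ n := Nat.cast_nonneg n
  have hpos : StrictPos (1 + (n : L0 P) * r) := strictPos_one.add_nonneg (mul_nonneg hn hr)
  obtain ⟨b, hb, hbn⟩ := hpos.exists_mul_eq_one
  have hle := hs _ (hR.smul_add_smul_mem hq.isLocal hq0 hsep hn hb.nonneg hbn hc)
  have hval : (1 + (n : L0 P) * r) * f (b • (c + (n : L0 P) • X)) = f c + n * f X := by
    simp only [map_smul, map_add, smul_eq_mul]
    linear_combination (f c + n * f X) * hbn
  have hmul := mul_le_mul_of_nonneg_left hle hpos.nonneg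
  rw [hval] at hmul
  rw [nsmul_eq_mul, sub_le_iff_le_add]
  calc s = (1 + (n : L0 P) * r) * s - n * (r * s) := by ring
    _ ≤ f c + n * f X - n * (r * s) := sub_le_sub_right hmul _
    _ = n * (f X - r * s) + f c := by ring

theorem IsSupport.le_of_represents [IsTopologicalAddGroup E] [ContinuousSMul (L0 P) E]
    [SFinite P] (hp : IsSupport C p) (hE : CondLocallyConvex P E)
    (hq : IsPenaltyOn (polarCone P K) q) (hq0 : q 0 = toExt 0)
    (hR : Represents (polarCone P K) q C) (hC : C.Nonempty) {f : WeakDual (L0 P) E}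
    (hf : f ∈ polarCone P K) : p f ≤ q f := by
  have hD : MeasurableSet {ω | p f ω ≠ ⊥} := (p f).measurable (measurableSet_singleton ⊥).compl
  set g : WeakDual (L0 P) E := ind P _ hD • f + ind P _ hD.compl • 0 with hg
  have hgK : g ∈ polarCone P K := concat_mem_polarCone hD hf (zero_mem_polarCone K)
  have hpg := hp.localOn (polarCone P K) _ hD f hf 0 (zero_mem_polarCone K)
  have hqg := hq.isLocal _ hD f hf 0 (zero_mem_polarCone K)
  rw [← hg] at hpg hqg
  obtain ⟨s, hs⟩ : ∃ s, toExt s = p g := by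
    refine exists_toExt_eq ?_ ?_
    · filter_upwards [hpg, ae_toExt (P := P) 0] with ω h1 h2 hbot
      by_cases hω : p f ω ≠ ⊥
      · exact hω ((h1.1 hω).symm.trans hbot)
      · rw [h1.2 hω, hp.map_zero hC, h2] at hbot
        exact EReal.coe_ne_bot _ hbot
    · obtain ⟨c, hc⟩ := hC
      filter_upwards [hp.ae_le g hc] with ω h1
      exact ne_top_of_le_ne_top (EReal.coe_ne_top _) h1
  have hle : p g ≤ q g := hs ▸ hR.toExt_le_of_forall_le hE hq hq0 hC hgK fun X hX =>
    toExt_le_toExt.1 (hs.le.trans (hp.le_toExt g hX))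
  refine le_iff_ae.2 ?_
  filter_upwards [le_iff_ae.1 hle, hpg, hqg] with ω h1 h2 h3
  by_cases hω : p f ω ≠ ⊥
  · rwa [h2.1 hω, h3.1 hω] at h1
  · rw [not_not.1 hω]
    exact bot_le

theorem StrictPos.inf {a b : L0 P} (ha : StrictPos a) (hb : StrictPos b) : StrictPos (a ⊓ b) := by
  filter_upwards [ha, hb, AEEqFun.coeFn_inf a b] with ω h1 h2 h3
  rw [h3]
  exact lt_inf_iff.2 ⟨h1, h2⟩

theorem UpperSemicontOn.le_map_zero (hq : UpperSemicontOn (polarCone P K) q)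
    {f : WeakDual (L0 P) E} (hf : f ∈ polarCone P K) {m : ExtL0 P}
    (hm : ∀ t : L0 P, StrictPos t → t ≤ 1 → m ≤ q (t • f)) : m ≤ q 0 := by
  have h0 : (0 : L0 P) ∈ closure {t | StrictPos t ∧ t ≤ 1} :=
    mem_closure_L0_iff.2 fun ε hε => by
      have ht := hε.inf strictPos_one
      refine ⟨ε ⊓ 1, ⟨ht, inf_le_right⟩, ?_⟩
      rw [sub_zero, abs_of_nonneg ht.nonneg]
      exact inf_le_left
  have hcont : Continuous fun t : L0 P => t • f :=
    WeakDual.continuous_of_continuous_eval fun x => continuous_id.mul continuous_const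
  have hcl : (⟨0, zero_mem_polarCone K⟩ : polarCone P K) ∈
      closure {g : polarCone P K | m ≤ q g} := by
    have himage := map_mem_closure (t := Subtype.val '' {g : polarCone P K | m ≤ q g}) hcont h0
      fun t ht => ⟨⟨t • f, smul_mem_polarCone ht.1.nonneg hf⟩, hm t ht.1 ht.2, rfl⟩
    rw [zero_smul] at himage
    exact closure_subtype.2 himage
  rwa [(hq m).closure_eq] at hcl

theorem ae_eq_bot_of_map_zero_eq_bot (hhom : PosHomogeneousOn (polarCone P K) q)
    (husc : UpperSemicontOn (polarCone P K) q) {f : WeakDual (L0 P) E}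
    (hf : f ∈ polarCone P K) : ∀ᵐ ω ∂P, q 0 ω = ⊥ → q f ω = ⊥ := by
  have hle : q f ⊓ toExt 0 ≤ q 0 := husc.le_map_zero hf fun t ht ht1 => le_iff_ae.2 <| by
    filter_upwards [hhom t ht f hf, ht, le_iff_ae.1 ht1, ae_one (P := P), ae_zero (P := P),
      ae_toExt (P := P) 0, AEEqFun.coeFn_inf (q f) (toExt 0)] with ω h1 h2 h3 h4 h5 h6 h7
    rw [h1, h7, h6, h5, EReal.coe_zero]
    rw [h4] at h3
    rcases le_total 0 (q f ω) with h | h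
    · exact inf_le_right.trans (mul_nonneg (EReal.coe_nonneg.2 h2.le) h)
    · have hneg : (t ω : EReal) * -q f ω ≤ -q f ω :=
        mul_le_of_le_one_left (EReal.neg_nonneg.2 h) (by exact_mod_cast h3)
      rw [mul_neg, EReal.neg_le_neg_iff] at hneg
      exact inf_le_left.trans hneg
  filter_upwards [le_iff_ae.1 hle, AEEqFun.coeFn_inf (q f) (toExt 0), ae_toExt (P := P) 0]
    with ω h1 h2 h3 h0
  rw [h0, h2, h3, le_bot_iff, min_eq_bot] at h1
  exact h1.resolve_right (EReal.coe_ne_bot _)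

theorem map_zero_of_nowhereFull (hq : IsPenaltyOn (polarCone P K) q)
    (hR : Represents (polarCone P K) q C) (hC : C.Nonempty) (hfull : NowhereFull P C) :
    q 0 = toExt 0 := by
  obtain ⟨c, hc⟩ := hC
  have hB : MeasurableSet {ω | q 0 ω = ⊥} := (q 0).measurable (measurableSet_singleton ⊥)
  have hbot : ∀ᵐ ω ∂P, q 0 ω ≠ ⊥ := by
    refine measure_eq_zero_iff_ae_notMem.1 (not_not.1 fun hne => ?_)
    obtain ⟨X, hX⟩ := hfull _ hB (pos_iff_ne_zero.2 hne)
    refine hX _ (hR.mem_of_ae_le fun f hf => ?_) (ind_smul_concat hB X c)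
    filter_upwards [ae_eq_bot_of_map_zero_eq_bot hq.posHomogeneous hq.upperSemicont hf,
      hR.ae_le hf hc, ae_map_eq_of_ind_smul_eq hB.compl f (ind_compl_smul_concat hB X c)]
      with ω h1 h2 h3
    by_cases hω : q 0 ω = ⊥
    · rw [h1 hω]
      exact bot_le
    · rwa [h3 hω]
  have htwo := hq.posHomogeneous _ (strictPos_const two_pos) 0 (zero_mem_polarCone K)
  rw [smul_zero] at htwo
  apply AEEqFun.ext
  filter_upwards [htwo, ae_const (P := P) 2, hbot, hR.ae_le (zero_mem_polarCone K) hc,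
    ae_toExt (P := P) 0, ae_zero (P := P)] with ω h1 h2 h3 h4 h5 h6
  have htop : q 0 ω ≠ ⊤ := ne_top_of_le_ne_top (EReal.coe_ne_top _) h4
  rw [h5, h6]
  rw [h2] at h1
  lift q 0 ω to ℝ using ⟨htop, h3⟩ with a
  rw [← EReal.coe_mul, EReal.coe_eq_coe_iff] at h1
  rw [EReal.coe_eq_coe_iff]
  linarith

end

end

end CondModule

open MeasureTheory CondModule in
theorem mainTheorem3_general {Ω : Type*} [MeasurableSpace Ω] (P : Measure Ω) [SFinite P]
    [NeZero P] {E : Type*} [AddCommGroup E] [Module (L0 P) E] [TopologicalSpace E]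
    [IsTopologicalAddGroup E] [ContinuousSMul (L0 P) E] (hE : CondLocallyConvex P E) (K C : Set E)
    (hCclosed : IsClosed C) (hCconvex : L0Convex P C) (hCK : ∀ X ∈ C, ∀ Y ∈ K, X + Y ∈ C)
    (hCstable : SigmaStable P C) :
    ∃ p : WeakDual (L0 P) E → ExtL0 P,
      IsPenaltyOn (polarCone P K) p ∧
      Represents (polarCone P K) p C ∧
      (∀ f ∈ polarCone P K, IsGLB ((fun X => toExt (f X)) '' C) (p f)) ∧
      (C.Nonempty → p 0 = toExt 0) ∧
      (C.Nonempty → ∀ q : WeakDual (L0 P) E → ExtL0 P,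
        IsPenaltyOn (polarCone P K) q → Represents (polarCone P K) q C →
        (q 0 = toExt 0 ∨ NowhereFull P C) → Set.EqOn q p (polarCone P K)) ∧
      (C = ∅ → ∀ q : WeakDual (L0 P) E → ExtL0 P, IsPenaltyOn (polarCone P K) q →
        (∃ f ∈ polarCone P K, ∀ᵐ ω ∂P, q f ω = ⊤) → Set.EqOn q p (polarCone P K)) := by
  obtain ⟨p, hp⟩ := exists_isSupport (P := P) C
  refine ⟨p, hp.isPenaltyOn _, hp.represents hE hCclosed hCconvex hCK hCstable, fun f _ => hp f,
    hp.map_zero, fun hC q hq hR h f hf => ?_, ?_⟩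
  · have hq0 : q 0 = toExt 0 := h.elim id (map_zero_of_nowhereFull hq hR hC)
    exact (hR.le_support hp hf).antisymm (hp.le_of_represents hE hq hq0 hR hC hf)
  · rintro rfl q hq htop f hf
    refine AEEqFun.ext ?_
    filter_upwards [hq.maximalInvariant htop f hf, hp.ae_eq_top f] with ω hqf hpf
    rw [hqf, hpf]

open MeasureTheory CondModule in
theorem mainTheorem3 {Ω : Type*} [MeasurableSpace Ω] (P : Measure Ω) [IsProbabilityMeasure P]
    {E : Type*} [AddCommGroup E] [Module (L0 P) E] [TopologicalSpace E]
    [IsTopologicalAddGroup E] [ContinuousSMul (L0 P) E] (hE : CondLocallyConvex P E)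
    (K : Set E) (hKcone : IsL0ConvexCone P K) (hKclosed : IsClosed K)
    (C : Set E) (hCclosed : IsClosed C) (hCconvex : L0Convex P C) (hCmono : MonotoneSet K C)
    (hCstable : SigmaStable P C) :
    ∃ p : WeakDual (L0 P) E → ExtL0 P,
      IsPenaltyOn (polarCone P K) p ∧
      Represents (polarCone P K) p C ∧
      (∀ f ∈ polarCone P K, IsGLB ((fun X => toExt (f X)) '' C) (p f)) ∧
      (C.Nonempty → p 0 = toExt 0) ∧
      (C.Nonempty → ∀ q : WeakDual (L0 P) E → ExtL0 P,
        IsPenaltyOn (polarCone P K) q → Represents (polarCone P K) q C →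
        (q 0 = toExt 0 ∨ NowhereFull P C) → Set.EqOn q p (polarCone P K)) ∧
      (C = ∅ → ∀ q : WeakDual (L0 P) E → ExtL0 P, IsPenaltyOn (polarCone P K) q →
        (∃ f ∈ polarCone P K, ∀ᵐ ω ∂P, q f ω = ⊤) → Set.EqOn q p (polarCone P K)) :=
  mainTheorem3_general P hE K C hCclosed hCconvex
    (fun _ hX _ hY => hCmono.subset (Set.mem_image2_of_mem hX hY)) hCstable
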